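/- Let $X$ be a set of $n\ge 1$ items and let $f_1,\dots,f_m$ ($m \ge 1$) be monotone submodular functions $2^X\to\mathbb{R}$ with $f_i(\emptyset)=0$. Put $M=\max_{i,\,j\in X} f_i(\{j\})$. Let $\mathcal I$ be the family of independent sets of a matroid of rank $k$ on $X$, and let $\mathcal P=\mathrm{conv}\{\mathbf 1_S : S\in\mathcal I\}$. Let $F_i(x)=\sum_{S\subseteq X} f_i(S)\prod_{j\in S}x_j\prod_{j\notin S}(1-x_j)$ be the multilinear extension of $f_i$ and let $G=\min_i F_i$ on $[0,1]^X$. Write $x\wedge\mathbf 1$ for the coordinatewise minimum with the all-ones vector. Suppose that the following oracles are given (measurable in their real-vector inputs and random bits): - a linear optimization oracle $LO$, which for $w\in\mathbb R^X$ returns an element of $\arg\max_{v\in\mathcal P} w^\top v$; - a best response to independent distributions oracle $BRI$, which for $x\in[0,1]^X$ returns an index $i$ that minimizes $F_i(x)$; - a stochastic first-order oracle $FO$, which for an index $i$ and $x\in[0,1]^X$ returns, using fresh random bits, an unbiased estimate of $\nabla F_i(x)$ with entries that are almost surely at most $M$ in absolute value. Let $T_1$ bound the time of a call of $LO$, and let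 $T_2$ bound the total time of a call of $BRI$ at a point followed by a call of $FO$ for the index returned. The answers of $LO$ and $FO$ have $n$ coordinates, so each call of these takes at least $n$ steps. Stochastic Frank-Wolfe (SFW) with parameters $u>0$, $K\ge 1$, $c\ge 1$ is the following algorithm. Start at $x^0=u\mathbf 1$. For $\ell=1,\dots,K$: for $t=1,\dots,c$ draw $z$ independently and uniformly from $[-u,u]^X$, put $y=x^{\ell-1}+z$, $q=y\wedge\mathbf 1$, $i=BRI(q)$, $g=FO(i,q)$, and let $\tilde\nabla_t$ be $g$ with the entries at coordinates $j$ with $y_j>1$ replaced by $0$; then let $v^\ell=LO\bigl(\frac1c\sum_t\tilde\nabla_t\bigr)$ and $x^\ell=x^{\ell-1}+\frac1K v^\ell$. Return $x_{final}=x^K-u\mathbf 1$. The running time counts one step for each scalar operation, each drawn coordinate of $z$ and each loop iteration, and the time of each oracle call. **Theorem.** There are absolute constants $C>0$ and $p\in\mathbb N$ such that for all $\epsilon,\delta>0$ and all $n,k,M$ there are parameters $u>0$, $K\ge1$, $c\ge1$, depending only on $\epsilon,\delta,n,k,M$, such that for every instance with these $n,k,M$ and all oracles as above: 1. $G$ attains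 a maximum on $\mathcal P$, and always $x_{final}\in\mathcal P$; 2. with probability at least $1-\delta$, both $$G(x_{final})\ \ge\ \Bigl(1-\frac1e\Bigr)\max_{x\in\mathcal P}G(x)-\epsilon \quad\text{and}\quad G(x^K\wedge\mathbf 1)\ \ge\ \Bigl(1-\frac1e\Bigr)\max_{x\in\mathcal P}G(x)-\epsilon ;$$ 3. the running time of SFW is always at most $$C\left(T_1\max\Bigl\{1,\frac{M^2k^2n}{\epsilon^2}\Bigr\}+T_2\max\Bigl\{1,\frac{k^4M^4n}{\epsilon^4}\Bigr\}\max\Bigl\{1,\log\frac1\delta\Bigr\}\right)\Bigl(\log\bigl(2+\tfrac{nkM}{\epsilon}\bigr)\Bigr)^p ,$$ that is, $\tilde{\mathcal O}\bigl(T_1\frac{M^2k^2n}{\epsilon^2}+T_2\frac{k^4M^4n}{\epsilon^4}\log\frac1\delta\bigr)$ whenever $\epsilon\le kM$ and $\delta\le 1/e$. -/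

import Mathlib

open MeasureTheory

noncomputable section

namespace SFW

/-! ### Set functions and their multilinear extensions -/

section Objective

variable {X ι : Type} [Fintype X] [DecidableEq X]

/-- Diminishing returns: `f(A ∪ {i}) - f(A) ≥ f(B ∪ {i}) - f(B)` for `A ⊆ B` and `i ∉ B`. -/
def IsSubmodular (f : Finset X → ℝ) : Prop :=
  ∀ A B : Finset X, A ⊆ B → ∀ i, i ∉ B → f (insert i B) - f B ≤ f (insert i A) - f A

/-- The multilinear extension `F(x) = ∑_S f(S) ∏_{j ∈ S} x_j ∏_{j ∉ S} (1 - x_j)`. -/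
def multilinearExt (f : Finset X → ℝ) (x : X → ℝ) : ℝ :=
  ∑ S : Finset X, f S * ((∏ j ∈ S, x j) * ∏ j ∈ Sᶜ, (1 - x j))

/-- The partial derivative `∂F/∂x_j`. -/
def partialDeriv (F : (X → ℝ) → ℝ) (x : X → ℝ) (j : X) : ℝ :=
  fderiv ℝ F x (Pi.single j 1)

/-- The pointwise minimum `G = min_i F_i` of the multilinear extensions. -/
def minExt [Fintype ι] [Nonempty ι] (f : ι → Finset X → ℝ) (x : X → ℝ) : ℝ :=
  Finset.univ.inf' Finset.univ_nonempty fun i => multilinearExt (f i) x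

/-- The cube `[0,1]^X`, the domain of the multilinear extensions. -/
def unitCube (X : Type) : Set (X → ℝ) := Set.Icc 0 1

/-- The indicator vector of a set of items. -/
def indicatorVec (S : Finset X) : X → ℝ := fun j => if j ∈ S then 1 else 0

/-- The matroid polytope: the convex hull of the indicator vectors of the independent sets. -/
def polytope (I : Matroid X) : Set (X → ℝ) :=
  convexHull ℝ (indicatorVec '' {S : Finset X | I.Indep (S : Set X)})

/-- The coordinatewise minimum of `x` and the all-ones vector. -/
def clip (x : X → ℝ) : X → ℝ := fun j => min (x j) 1

end Objective

/-! ### Counting steps -/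

/-- A value together with the number of steps spent on computing it. -/
structure Timed (α : Type) where
  val : α
  time : ℕ

/-- Sequential composition adds the numbers of steps. -/
instance : Monad Timed where
  pure a := ⟨a, 0⟩
  bind p q := ⟨(q p.val).val, p.time + (q p.val).time⟩

/-- One step of loop control. -/
def tick : Timed Unit := ⟨(), 1⟩

section VectorOps

variable {X : Type} [Fintype X]

/-- Write a constant into each coordinate: one step per coordinate. -/
def constT (a : ℝ) : Timed (X → ℝ) := ⟨fun _ => a, Fintype.card X⟩

/-- Draw a random vector, here read from the random tape: one step per coordinate. -/
def drawT (z : X → ℝ) : Timed (X → ℝ) := ⟨z, Fintype.card X⟩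

/-- Vector addition: one step per coordinate. -/
def addT (x y : X → ℝ) : Timed (X → ℝ) := ⟨fun j => x j + y j, Fintype.card X⟩

/-- Subtracting a scalar from each coordinate: one step per coordinate. -/
def subConstT (x : X → ℝ) (a : ℝ) : Timed (X → ℝ) := ⟨fun j => x j - a, Fintype.card X⟩

/-- Dividing by a scalar: one step per coordinate. -/
def divT (x : X → ℝ) (a : ℝ) : Timed (X → ℝ) := ⟨fun j => x j / a, Fintype.card X⟩

/-- Coordinatewise minimum with `1`: one step per coordinate. -/
def clipT (x : X → ℝ) : Timed (X → ℝ) := ⟨clip x, Fintype.card X⟩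

/-- Set to zero the coordinates of `g` at which `y` exceeds `1`: one step per coordinate. -/
def maskT (y g : X → ℝ) : Timed (X → ℝ) :=
  ⟨fun j => if y j ≤ 1 then g j else 0, Fintype.card X⟩

end VectorOps

/-! ### The three oracles -/

section Oracles

variable {X ι : Type} [Fintype X]

/-- A linear optimization oracle over `P`: for each objective `w` it returns a maximizer of
`v ↦ ∑ j, w j * v j` over `P`. Its answer has `|X|` coordinates, so that writing it down takes
at least `|X|` steps. -/
structure LinearOracle (P : Set (X → ℝ)) where
  answer : (X → ℝ) → X → ℝ
  time : (X → ℝ) → ℕ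
  measurable_answer : Measurable answer
  answer_mem : ∀ w, answer w ∈ P
  le_answer : ∀ w, ∀ v ∈ P, ∑ j, w j * v j ≤ ∑ j, w j * answer w j
  card_le_time : ∀ w, Fintype.card X ≤ time w

/-- A best response to independent distributions oracle: at each `x ∈ [0,1]^X` it returns an index
`i` for which `F_i(x)` is smallest. -/
structure BestResponseOracle [DecidableEq X] (f : ι → Finset X → ℝ) where
  answer : (X → ℝ) → ι
  time : (X → ℝ) → ℕ
  measurableSet_answer : ∀ i, MeasurableSet {x | answer x = i}
  answer_le : ∀ x ∈ unitCube X, ∀ i,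
    multilinearExt (f (answer x)) x ≤ multilinearExt (f i) x

/-- A stochastic first-order oracle, which draws its random bits from the probability space
`(Ω, Q)`: at each `x ∈ [0,1]^X` and for each `i` it returns an unbiased estimate of `∇F_i(x)`,
whose entries are bounded by `M` in absolute value. Its answer has `|X|` coordinates, so that
writing it down takes at least `|X|` steps. -/
structure FirstOrderOracle [DecidableEq X] (f : ι → Finset X → ℝ) (M : ℝ)
    {Ω : Type*} [MeasurableSpace Ω] (Q : Measure Ω) where
  answer : ι → (X → ℝ) → Ω → X → ℝ
  time : ι → (X → ℝ) → Ω → ℕ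
  measurable_answer : ∀ i, Measurable (Function.uncurry (answer i))
  unbiased : ∀ i, ∀ x ∈ unitCube X, ∀ j,
    ∫ ω, answer i x ω j ∂Q = partialDeriv (multilinearExt (f i)) x j
  abs_le : ∀ i, ∀ x ∈ unitCube X, ∀ᵐ ω ∂Q, ∀ j, |answer i x ω j| ≤ M
  card_le_time : ∀ i x ω, Fintype.card X ≤ time i x ω

/-- A call of the linear optimization oracle. -/
def LinearOracle.call {P : Set (X → ℝ)} (lo : LinearOracle P) (w : X → ℝ) : Timed (X → ℝ) :=
  ⟨lo.answer w, lo.time w⟩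

/-- A call of the best response oracle. -/
def BestResponseOracle.call [DecidableEq X] {f : ι → Finset X → ℝ} (bri : BestResponseOracle f)
    (x : X → ℝ) : Timed ι :=
  ⟨bri.answer x, bri.time x⟩

/-- A call of the first-order oracle with random bits `ω`. -/
def FirstOrderOracle.call [DecidableEq X] {f : ι → Finset X → ℝ} {M : ℝ}
    {Ω : Type*} [MeasurableSpace Ω] {Q : Measure Ω} (fo : FirstOrderOracle f M Q)
    (i : ι) (x : X → ℝ) (ω : Ω) : Timed (X → ℝ) :=
  ⟨fo.answer i x ω, fo.time i x ω⟩

end Oracles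

/-! ### The algorithm -/

section Algorithm

variable {X ι : Type} [Fintype X] [DecidableEq X] {f : ι → Finset X → ℝ} {M : ℝ}
  {Ω : Type*} [MeasurableSpace Ω] {Q : Measure Ω} {P : Set (X → ℝ)}

/-- One sample of the gradient of `x ↦ G(x ∧ 1)` at the perturbed point `x + z`. The pair `s`
holds the perturbation `z` and the random bits of the first-order oracle. The oracles are queried
at `(x + z) ∧ 1`, and since `y ↦ G(y ∧ 1)` does not depend on a coordinate that exceeds `1`, the
corresponding entries of the gradient are zero. -/
def sampleGradient (bri : BestResponseOracle f) (fo : FirstOrderOracle f M Q)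
    (x : X → ℝ) (s : (X → ℝ) × Ω) : Timed (X → ℝ) := do
  let z ← drawT s.1
  let y ← addT x z
  let q ← clipT y
  let i ← bri.call q
  let g ← fo.call i q s.2
  maskT y g

/-- The average of `c` gradient samples at `x`. -/
def averageGradient (bri : BestResponseOracle f) (fo : FirstOrderOracle f M Q) {c : ℕ}
    (s : Fin c → (X → ℝ) × Ω) (x : X → ℝ) : Timed (X → ℝ) := do
  let init ← constT 0
  let total ← (List.finRange c).foldlM (init := init) fun acc t => do
    tick
    let g ← sampleGradient bri fo x (s t)
    addT acc g
  divT total (c : ℝ)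

/-- One iteration of Stochastic Frank-Wolfe with step size `1 / K`. -/
def frankWolfeStep (lo : LinearOracle P) (bri : BestResponseOracle f)
    (fo : FirstOrderOracle f M Q) (K : ℕ) {c : ℕ} (s : Fin c → (X → ℝ) × Ω) (x : X → ℝ) :
    Timed (X → ℝ) := do
  tick
  let g ← averageGradient bri fo s x
  let v ← lo.call g
  let d ← divT v (K : ℝ)
  addT x d

/-- Stochastic Frank-Wolfe: start at `x⁰ = u𝟏`, perform `K` iterations with `c` gradient samples
each, and return `x^K` together with `x_final = x^K - u𝟏`. The random tape holds, for each
iteration and each sample, a perturbation and fresh random bits for the first-order oracle. -/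
def stochasticFrankWolfe (lo : LinearOracle P) (bri : BestResponseOracle f)
    (fo : FirstOrderOracle f M Q) (u : ℝ) (K c : ℕ) (tape : Fin K → Fin c → (X → ℝ) × Ω) :
    Timed ((X → ℝ) × (X → ℝ)) := do
  let x₀ ← constT u
  let xK ← (List.finRange K).foldlM (init := x₀) fun x l =>
    frankWolfeStep lo bri fo K (tape l) x
  let xfinal ← subConstT xK u
  return (xK, xfinal)

/-- The uniform distribution `μ(u)` on the ball of radius `u` in the `ℓ_∞` norm, which is the norm
that `X → ℝ` carries. -/
def uniformNoise (X : Type) [Fintype X] (u : ℝ) : Measure (X → ℝ) :=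
  ProbabilityTheory.cond volume (Metric.closedBall (0 : X → ℝ) u)

/-- The law of the random tape: all perturbations are drawn from `μ(u)`, all random bits of the
first-order oracle from `Q`, and all draws are independent. -/
def tapeLaw (X : Type) [Fintype X] (Q : Measure Ω) (u : ℝ) (K c : ℕ) :
    Measure (Fin K → Fin c → (X → ℝ) × Ω) :=
  Measure.pi fun _ => Measure.pi fun _ => (uniformNoise X u).prod Q

end Algorithm

end SFW

end

/-! Frank-Wolfe needs an ascent direction that varies slowly, but `G` is a minimum and has kinks.
Along nonnegative directions, however, each `F_i` is concave: its partial derivatives are the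
multilinear extensions of the marginals, hence nonnegative, at most `M`, and decreasing by
submodularity. The gradient of the minimizing `F_i`, masked where a coordinate exceeds `1`,
therefore acts as a supergradient of `y ↦ G(y ∧ 1)` in those directions
(`clippedExt_add_ascent_le`), and it certifies the distance to any competitor `w` in the cube
(`le_clippedExt_add_ascent`).

Averaging over the noise removes the kinks. Integrating out the `j`-th noise coordinate turns the
`j`-th mean supergradient into a difference quotient of `G(y ∧ 1)` over an interval of length `2u`
(`meanAscent_eq`), so it falls by at most `M / u` per unit of `ℓ_1` distance (`meanAscent_le_add`).
Starting at `u𝟏` keeps all perturbed points nonnegative almost surely.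

Points of the polytope have `ℓ_1` norm at most `k`, so curvature costs `M k² / (u K²)` per step, and
gradient estimates that are off by at most `e` in each entry cost `2 e k / K`. Up to these errors
the gap to the optimum shrinks by the factor `1 - 1/K` in each step (`smoothedExt_step`); `K` steps
leave at most the fraction `1/e`, with `e` now Euler's number. Undoing the smoothing costs `2 u M
n`.

The estimates are accurate by Hoeffding's inequality and a union bound over coordinates and
iterations. Adaptivity is harmless because the samples of an iteration are independent of the point
at which they are used (`measure_adapted_le`). Making each of the three errors at most `ε/3`
determines `u`, `K` and `c`. If `k M ≤ ε`, the guarantee is trivial, since `0 ≤ G ≤ k M` on the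
polytope. -/

namespace SFW

/-! ### Multilinear extensions -/

section Multilinear

variable {X : Type} [Fintype X] [DecidableEq X]

/-- The marginal value of `j`, as a set function that does not depend on `j`. -/
def marginal (f : Finset X → ℝ) (j : X) (S : Finset X) : ℝ := f (insert j S) - f (S.erase j)

/-- The probability of `S` among the subsets of the items other than `j`. -/
def weightErase (x : X → ℝ) (j : X) (S : Finset X) : ℝ :=
  (∏ i ∈ S, x i) * ∏ i ∈ Sᶜ.erase j, (1 - x i)

/-- Conditioning on whether the random set contains `j`. The outer weights no longer involve `x j`,
which exhibits the extension as affine in that coordinate. -/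
theorem multilinearExt_eq_sum_erase (f : Finset X → ℝ) (x : X → ℝ) (j : X) :
    multilinearExt f x = ∑ S ∈ (Finset.univ.erase j).powerset,
      weightErase x j S * ((1 - x j) * f S + x j * f (insert j S)) := by
  have huniv : (Finset.univ : Finset (Finset X)) =
      (insert j (Finset.univ.erase j)).powerset := by
    rw [Finset.insert_erase (Finset.mem_univ j), Finset.powerset_univ]
  unfold multilinearExt
  rw [huniv, Finset.sum_powerset_insert (Finset.notMem_erase j _), ← Finset.sum_add_distrib]
  refine Finset.sum_congr rfl fun S hS => ?_
  have hj : j ∉ S := fun h => by simpa using Finset.mem_powerset.1 hS h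
  have hc : j ∈ Sᶜ := Finset.mem_compl.2 hj
  rw [Finset.prod_insert hj, Finset.compl_insert, weightErase,
    ← Finset.mul_prod_erase Sᶜ (fun i => 1 - x i) hc]
  ring

theorem weightErase_update (x : X → ℝ) (j : X) (s : ℝ) {S : Finset X}
    (hS : S ∈ (Finset.univ.erase j).powerset) :
    weightErase (Function.update x j s) j S = weightErase x j S := by
  have hj : j ∉ S := fun h => by simpa using Finset.mem_powerset.1 hS h
  unfold weightErase
  congr 1
  · exact Finset.prod_congr rfl fun i hi => by
      rw [Function.update_of_ne (ne_of_mem_of_not_mem hi hj)]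
  · exact Finset.prod_congr rfl fun i hi => by
      rw [Function.update_of_ne (Finset.ne_of_mem_erase hi)]

theorem multilinearExt_marginal (f : Finset X → ℝ) (x : X → ℝ) (j : X) :
    multilinearExt (marginal f j) x = ∑ S ∈ (Finset.univ.erase j).powerset,
      weightErase x j S * (f (insert j S) - f S) := by
  rw [multilinearExt_eq_sum_erase _ x j]
  refine Finset.sum_congr rfl fun S hS => ?_
  have hj : j ∉ S := fun h => by simpa using Finset.mem_powerset.1 hS h
  simp only [marginal, Finset.insert_idem, Finset.erase_insert hj, Finset.erase_eq_of_notMem hj]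
  ring

theorem multilinearExt_update_sub (f : Finset X → ℝ) (x : X → ℝ) (j : X) (s : ℝ) :
    multilinearExt f (Function.update x j s) - multilinearExt f x =
      (s - x j) * multilinearExt (marginal f j) x := by
  rw [multilinearExt_marginal, multilinearExt_eq_sum_erase f x j,
    multilinearExt_eq_sum_erase f _ j, ← Finset.sum_sub_distrib, Finset.mul_sum]
  refine Finset.sum_congr rfl fun S hS => ?_
  rw [weightErase_update x j s hS, Function.update_self]
  ring

theorem multilinearExt_nonneg {f : Finset X → ℝ} (hf : ∀ S, 0 ≤ f S) {x : X → ℝ}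
    (hx : x ∈ unitCube X) : 0 ≤ multilinearExt f x :=
  Finset.sum_nonneg fun S _ => mul_nonneg (hf S) <| mul_nonneg
    (Finset.prod_nonneg fun j _ => hx.1 j)
    (Finset.prod_nonneg fun j _ => sub_nonneg.2 (hx.2 j))

theorem multilinearExt_sub (f g : Finset X → ℝ) (x : X → ℝ) :
    multilinearExt (fun S => f S - g S) x = multilinearExt f x - multilinearExt g x := by
  simp only [multilinearExt, sub_mul, Finset.sum_sub_distrib]

/-- The weights add up to `1`: expand the product of the factors `x j + (1 - x j)` over subsets. -/
theorem multilinearExt_const (a : ℝ) (x : X → ℝ) : multilinearExt (fun _ => a) x = a := by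
  have h := Finset.prod_add x (fun j => 1 - x j) Finset.univ
  simp only [add_sub_cancel, Finset.prod_const_one, Finset.powerset_univ,
    ← Finset.compl_eq_univ_sdiff] at h
  rw [multilinearExt, ← Finset.mul_sum, ← h, mul_one]

theorem multilinearExt_le_of_le {f g : Finset X → ℝ} (h : ∀ S, f S ≤ g S) {x : X → ℝ}
    (hx : x ∈ unitCube X) : multilinearExt f x ≤ multilinearExt g x := by
  have := multilinearExt_nonneg (f := fun S => g S - f S) (fun S => sub_nonneg.2 (h S)) hx
  rw [multilinearExt_sub] at this
  linarith

theorem continuous_multilinearExt (f : Finset X → ℝ) : Continuous (multilinearExt f) := by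
  unfold multilinearExt
  fun_prop

theorem differentiable_multilinearExt (f : Finset X → ℝ) :
    Differentiable ℝ (multilinearExt f) := by
  unfold multilinearExt
  fun_prop

theorem multilinearExt_zero (f : Finset X → ℝ) : multilinearExt f 0 = f ∅ := by
  rw [multilinearExt, Finset.sum_eq_single ∅]
  · simp
  · intro S _ hS
    obtain ⟨j, hj⟩ := Finset.nonempty_iff_ne_empty.2 hS
    rw [Finset.prod_eq_zero hj (by simp)]
    simp
  · simp

/-- Along the `j`-th axis the extension is affine, with slope given by `multilinearExt_update_sub`.
-/
theorem partialDeriv_multilinearExt (f : Finset X → ℝ) (x : X → ℝ) (j : X) :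
    partialDeriv (multilinearExt f) x j = multilinearExt (marginal f j) x := by
  have h1 : HasDerivAt (fun t : ℝ => x + t • (Pi.single j 1 : X → ℝ)) (Pi.single j 1) 0 := by
    simpa using ((hasDerivAt_id (0 : ℝ)).smul_const (Pi.single j 1 : X → ℝ)).const_add x
  have h2 : HasFDerivAt (multilinearExt f) (fderiv ℝ (multilinearExt f) x)
      (x + (0 : ℝ) • (Pi.single j 1 : X → ℝ)) := by
    simpa using (differentiable_multilinearExt f x).hasFDerivAt
  have h3 := h2.comp_hasDerivAt (0 : ℝ) h1
  have h4 : HasDerivAt (multilinearExt f ∘ fun t : ℝ => x + t • (Pi.single j 1 : X → ℝ))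
      (multilinearExt (marginal f j) x) 0 := by
    have heq : (multilinearExt f ∘ fun t : ℝ => x + t • (Pi.single j 1 : X → ℝ)) =
        fun t => multilinearExt f x + t * multilinearExt (marginal f j) x := by
      funext t
      have hu : x + t • (Pi.single j 1 : X → ℝ) = Function.update x j (x j + t) := by
        funext i
        by_cases h : i = j
        · subst h; simp
        · simp [h]
      have := multilinearExt_update_sub f x j (x j + t)
      simp only [Function.comp_apply, hu]
      linarith
    rw [heq]
    simpa using ((hasDerivAt_id (0 : ℝ)).mul_const (multilinearExt (marginal f j) x)).const_add
      (multilinearExt f x)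
  exact h3.unique h4

omit [Fintype X] in
theorem piecewise_mem_unitCube {a b : X → ℝ} (ha : a ∈ unitCube X) (hb : b ∈ unitCube X)
    (S : Finset X) : S.piecewise b a ∈ unitCube X :=
  Finset.piecewise_mem_Icc_of_mem_of_mem S hb ha

theorem multilinearExt_piecewise_insert (f : Finset X → ℝ) (a b : X → ℝ) {j : X} {S : Finset X}
    (hj : j ∉ S) :
    multilinearExt f ((insert j S).piecewise b a) =
      multilinearExt f (S.piecewise b a) +
        (b j - a j) * multilinearExt (marginal f j) (S.piecewise b a) := by
  have := multilinearExt_update_sub f (S.piecewise b a) j (b j)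
  rw [Finset.piecewise_insert]
  simp only [Finset.piecewise_eq_of_notMem _ _ _ hj] at this
  linarith

omit [Fintype X] in
theorem marginal_nonneg {f : Finset X → ℝ} (hf : Monotone f) (j : X) (S : Finset X) :
    0 ≤ marginal f j S :=
  sub_nonneg.2 (hf ((Finset.erase_subset j S).trans (Finset.subset_insert j S)))

/-- Move from `a` to `b` one coordinate at a time through the hybrid points `S.piecewise b a`; each
move adds a nonnegative multiple of a marginal. The two concavity inequalities below use the same
path. -/
theorem multilinearExt_mono {f : Finset X → ℝ} (hf : Monotone f) {a b : X → ℝ}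
    (ha : a ∈ unitCube X) (hb : b ∈ unitCube X) (hab : a ≤ b) :
    multilinearExt f a ≤ multilinearExt f b := by
  have h : ∀ S : Finset X, multilinearExt f a ≤ multilinearExt f (S.piecewise b a) := by
    intro S
    induction S using Finset.induction_on with
    | empty => simp
    | insert j S hj ih =>
      rw [multilinearExt_piecewise_insert f a b hj]
      have := mul_nonneg (sub_nonneg.2 (hab j)) (multilinearExt_nonneg (marginal_nonneg hf j)
        (piecewise_mem_unitCube ha hb S))
      linarith
  simpa using h Finset.univ

-- The only place where submodularity is unfolded. Removing `j` from both sets first covers sets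
-- that already contain it.
omit [Fintype X] in
theorem marginal_antitone {f : Finset X → ℝ} (hf : IsSubmodular f) (j : X) :
    Antitone (marginal f j) := by
  intro S T hST
  have h := hf (S.erase j) (T.erase j) (Finset.erase_subset_erase j hST) j
    (Finset.notMem_erase j T)
  have hi : ∀ U : Finset X, insert j (U.erase j) = insert j U := fun U => by
    ext i; simp only [Finset.mem_insert, Finset.mem_erase]; tauto
  rw [hi, hi] at h
  exact h

omit [Fintype X] in
theorem marginal_le {f : Finset X → ℝ} (hf : IsSubmodular f) (h0 : f ∅ = 0) (j : X)
    (S : Finset X) : marginal f j S ≤ f {j} := by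
  have := marginal_antitone hf j (Finset.empty_subset S)
  simpa [marginal, h0] using this

/-- The negated marginal is a monotone set function, so `multilinearExt_mono` applies to it. -/
theorem multilinearExt_marginal_anti {f : Finset X → ℝ} (hf : IsSubmodular f) (j : X)
    {a b : X → ℝ} (ha : a ∈ unitCube X) (hb : b ∈ unitCube X) (hab : a ≤ b) :
    multilinearExt (marginal f j) b ≤ multilinearExt (marginal f j) a := by
  have hm : Monotone (fun S => 0 - marginal f j S) := fun S T hST =>
    sub_le_sub_left (marginal_antitone hf j hST) 0
  have := multilinearExt_mono hm ha hb hab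
  rw [multilinearExt_sub, multilinearExt_sub, multilinearExt_const, multilinearExt_const] at this
  linarith

theorem multilinearExt_marginal_nonneg {f : Finset X → ℝ} (hf : Monotone f) (j : X)
    {x : X → ℝ} (hx : x ∈ unitCube X) : 0 ≤ multilinearExt (marginal f j) x :=
  multilinearExt_nonneg (marginal_nonneg hf j) hx

theorem multilinearExt_marginal_le {f : Finset X → ℝ} (hf : IsSubmodular f) (h0 : f ∅ = 0) (j : X)
    {x : X → ℝ} (hx : x ∈ unitCube X) : multilinearExt (marginal f j) x ≤ f {j} := by
  have := multilinearExt_le_of_le (marginal_le hf h0 j) hx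
  rwa [multilinearExt_const] at this

/-- A multilinear extension is concave along nonnegative directions. -/
theorem multilinearExt_le_add_sum {f : Finset X → ℝ} (hf : IsSubmodular f) {a b : X → ℝ}
    (ha : a ∈ unitCube X) (hb : b ∈ unitCube X) (hab : a ≤ b) :
    multilinearExt f b ≤ multilinearExt f a +
      ∑ j, multilinearExt (marginal f j) a * (b j - a j) := by
  have h : ∀ S : Finset X, multilinearExt f (S.piecewise b a) ≤ multilinearExt f a +
      ∑ j ∈ S, multilinearExt (marginal f j) a * (b j - a j) := by
    intro S
    induction S using Finset.induction_on with
    | empty => simp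
    | insert j S hj ih =>
      rw [multilinearExt_piecewise_insert f a b hj, Finset.sum_insert hj]
      -- The hybrid point lies above `a`, so its slope is at most the slope at `a`.
      have := mul_le_mul_of_nonneg_left (multilinearExt_marginal_anti hf j ha
        (piecewise_mem_unitCube ha hb S) (Finset.le_piecewise_of_le_of_le S hab le_rfl))
        (sub_nonneg.2 (hab j))
      linarith
  simpa using h Finset.univ

/-- The hybrid points lie below `b`, so every slope along the path is at least the one at the far
end. -/
theorem multilinearExt_add_sum_le {f : Finset X → ℝ} (hf : IsSubmodular f) {a b : X → ℝ}
    (ha : a ∈ unitCube X) (hb : b ∈ unitCube X) (hab : a ≤ b) :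
    multilinearExt f a + ∑ j, multilinearExt (marginal f j) b * (b j - a j) ≤
      multilinearExt f b := by
  have h : ∀ S : Finset X, multilinearExt f a +
      ∑ j ∈ S, multilinearExt (marginal f j) b * (b j - a j) ≤
        multilinearExt f (S.piecewise b a) := by
    intro S
    induction S using Finset.induction_on with
    | empty => simp
    | insert j S hj ih =>
      rw [multilinearExt_piecewise_insert f a b hj, Finset.sum_insert hj]
      have := mul_le_mul_of_nonneg_left (multilinearExt_marginal_anti hf j
        (piecewise_mem_unitCube ha hb S) hb (Finset.piecewise_le_of_le_of_le S le_rfl hab))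
        (sub_nonneg.2 (hab j))
      linarith
  simpa using h Finset.univ

end Multilinear

/-! ### Product measures, uniform noise and concave functions -/

section Measure

/-- Resampling one coordinate preserves a product of probability measures. -/
theorem measurePreserving_update_pi {ι : Type*} [Fintype ι] [DecidableEq ι] {α : ι → Type*}
    [∀ i, MeasurableSpace (α i)] (μ : ∀ i, Measure (α i)) [∀ i, IsProbabilityMeasure (μ i)]
    (i : ι) :
    MeasurePreserving (fun p : (∀ i, α i) × α i => Function.update p.1 i p.2)
      ((Measure.pi μ).prod (μ i)) (Measure.pi μ) := by
  have hm : Measurable (fun p : (∀ i, α i) × α i => Function.update p.1 i p.2) :=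
    measurable_update'
  refine ⟨hm, (Measure.pi_eq fun s hs => ?_).symm⟩
  rw [Measure.map_apply hm (MeasurableSet.univ_pi hs)]
  -- Overwriting coordinate `i` frees its old value and puts the constraint `s i` on the new one.
  have hpre : (fun p : (∀ i, α i) × α i => Function.update p.1 i p.2) ⁻¹' Set.univ.pi s =
      (Set.univ.pi (Function.update s i Set.univ)) ×ˢ s i := by
    ext ⟨z, a⟩
    simp only [Set.mem_preimage, Set.mem_pi, Set.mem_univ, true_imp_iff, Set.mem_prod]
    constructor
    · intro h
      refine ⟨fun j => ?_, by simpa using h i⟩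
      by_cases hj : j = i
      · subst hj; simp
      · simpa [hj] using h j
    · rintro ⟨h1, h2⟩ j
      by_cases hj : j = i
      · subst hj; simpa using h2
      · simpa [hj] using h1 j
  rw [hpre, Measure.prod_prod, Measure.pi_pi, ← Finset.mul_prod_erase Finset.univ _
    (Finset.mem_univ i), ← Finset.mul_prod_erase Finset.univ (fun j => μ j (s j))
    (Finset.mem_univ i)]
  have : ∏ j ∈ Finset.univ.erase i, μ j (Function.update s i Set.univ j) =
      ∏ j ∈ Finset.univ.erase i, μ j (s j) :=
    Finset.prod_congr rfl fun j hj => by rw [Function.update_of_ne (Finset.ne_of_mem_erase hj)]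
  rw [this]
  simp [mul_comm]

/-- The uniform distribution on `[-u, u]`. -/
noncomputable def uniformInterval (u : ℝ) : Measure ℝ :=
  ProbabilityTheory.cond volume (Set.Icc (-u) u)

variable {u : ℝ}

theorem isProbabilityMeasure_uniformInterval (hu : 0 < u) :
    IsProbabilityMeasure (uniformInterval u) := by
  refine ProbabilityTheory.cond_isProbabilityMeasure_of_finite ?_ ?_
  · rw [Real.volume_Icc]; simp; linarith
  · rw [Real.volume_Icc]; simp

/-- The `ℓ_∞` ball is a product of intervals, so the normalizing volume factors as well.
Independence of the coordinates is what allows one of them to be integrated out alone. -/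
theorem uniformNoise_eq_pi (X : Type) [Fintype X] (hu : 0 < u) :
    uniformNoise X u = Measure.pi fun _ : X => uniformInterval u := by
  have := isProbabilityMeasure_uniformInterval hu
  symm
  refine Measure.pi_eq fun s hs => ?_
  have hb : Metric.closedBall (0 : X → ℝ) u = Set.univ.pi fun _ => Set.Icc (-u) u := by
    rw [closedBall_pi _ hu.le]
    simp [Real.closedBall_eq_Icc]
  have hI : ∀ j, uniformInterval u (s j) =
      (volume (Set.Icc (-u) u))⁻¹ * volume (Set.Icc (-u) u ∩ s j) := fun j =>
    ProbabilityTheory.cond_apply measurableSet_Icc _ _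
  rw [uniformNoise, hb, ProbabilityTheory.cond_apply
    (MeasurableSet.univ_pi fun _ => measurableSet_Icc), ← Set.pi_inter_distrib, volume_pi_pi,
    volume_pi_pi]
  simp only [hI, Finset.prod_mul_distrib]
  congr 1
  simp only [Finset.prod_const, ENNReal.inv_pow]

theorem isProbabilityMeasure_uniformNoise (X : Type) [Fintype X] (hu : 0 < u) :
    IsProbabilityMeasure (uniformNoise X u) := by
  have := isProbabilityMeasure_uniformInterval hu
  rw [uniformNoise_eq_pi X hu]
  infer_instance

theorem ae_uniformNoise (X : Type) [Fintype X] (u : ℝ) :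
    ∀ᵐ z ∂uniformNoise X u, ∀ j, |z j| ≤ u := by
  have h : ∀ᵐ z ∂uniformNoise X u, z ∈ Metric.closedBall (0 : X → ℝ) u :=
    ProbabilityTheory.ae_cond_mem Metric.isClosed_closedBall.measurableSet
  filter_upwards [h] with z hz j
  rw [mem_closedBall_zero_iff] at hz
  exact (norm_le_pi_norm z j).trans hz

theorem integral_uniformInterval (hu : 0 < u) (g : ℝ → ℝ) :
    ∫ s, g s ∂uniformInterval u = (∫ s in (-u)..u, g s) / (2 * u) := by
  rw [uniformInterval, ProbabilityTheory.cond, integral_smul_measure, Real.volume_Icc,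
    intervalIntegral.integral_of_le (by linarith), integral_Icc_eq_integral_Ioc,
    ENNReal.toReal_inv, ENNReal.toReal_ofReal (by linarith), smul_eq_mul, sub_neg_eq_add,
    ← two_mul, inv_mul_eq_div]

/-- Resampling one coordinate of the uniform noise. -/
theorem integral_uniformNoise_eq {X : Type} [Fintype X] [DecidableEq X] (hu : 0 < u) (j : X)
    {g : (X → ℝ) → ℝ} (hg : Integrable g (uniformNoise X u)) :
    ∫ z, g z ∂uniformNoise X u =
      ∫ z, (∫ s in (-u)..u, g (Function.update z j s)) / (2 * u) ∂uniformNoise X u := by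
  have := isProbabilityMeasure_uniformInterval hu
  rw [uniformNoise_eq_pi X hu] at hg ⊢
  have hmp := measurePreserving_update_pi (fun _ : X => uniformInterval u) j
  have hint := hmp.integrable_comp_of_integrable hg
  calc ∫ z, g z ∂Measure.pi (fun _ : X => uniformInterval u)
      = ∫ p : (X → ℝ) × ℝ, g (Function.update p.1 j p.2)
          ∂(Measure.pi fun _ : X => uniformInterval u).prod (uniformInterval u) := by
        conv_lhs => rw [← hmp.map_eq]
        exact integral_map hmp.measurable.aemeasurable
          (hmp.map_eq.symm ▸ hg.aestronglyMeasurable)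
    _ = _ := by
        refine (integral_prod _ hint).trans ?_
        exact integral_congr_ae (Filter.Eventually.of_forall fun z =>
          integral_uniformInterval hu _)

/-- A function with a supergradient at each point is the integral of the supergradient. -/
theorem integral_supergradient {a b : ℝ} (hab : a ≤ b) {φ γ : ℝ → ℝ}
    (h : ∀ s ∈ Set.Icc a b, ∀ t ∈ Set.Icc a b, φ t ≤ φ s + γ s * (t - s))
    (hφ : ContinuousOn φ (Set.Icc a b)) :
    ∫ s in a..b, γ s = φ b - φ a := by
  -- A monotone `γ` has at most countably many discontinuities. Elsewhere the supergradient
  -- inequalities at `s` and at `t` squeeze the difference quotient, so `φ' = γ`, and the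
  -- fundamental theorem of calculus tolerates the countable exceptional set.
  have hanti : AntitoneOn γ (Set.Icc a b) := by
    intro s hs t ht hst
    rcases hst.eq_or_lt with rfl | hlt
    · exact le_rfl
    · have h1 := h s hs t ht
      have h2 := h t ht s hs
      by_contra hc
      nlinarith [mul_pos (sub_pos.2 hlt) (sub_pos.2 (not_le.1 hc))]
  refine integral_eq_of_hasDerivAt_off_countable_of_le φ γ hab
    hanti.countable_not_continuousWithinAt hφ ?_ ?_
  · rintro s ⟨hs, hns⟩
    have hsI := Set.Ioo_subset_Icc_self hs
    have hnhds : Set.Icc a b ∈ nhds s := Icc_mem_nhds hs.1 hs.2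
    have hcont : ContinuousAt γ s := by
      have : ContinuousWithinAt γ (Set.Icc a b) s := by
        by_contra hc
        exact hns ⟨hsI, hc⟩
      exact this.continuousAt hnhds
    rw [hasDerivAt_iff_isLittleO, Asymptotics.isLittleO_iff]
    intro c hc
    filter_upwards [hnhds, hcont.eventually (Metric.ball_mem_nhds _ hc)] with t ht hγ
    have h1 := h s hsI t ht
    have h2 := h t ht s hsI
    have h3 : |γ t - γ s| ≤ c := by
      rw [Real.dist_eq] at hγ
      exact hγ.le
    have h4 : |(γ t - γ s) * (t - s)| ≤ c * |t - s| := by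
      rw [abs_mul]; exact mul_le_mul_of_nonneg_right h3 (abs_nonneg _)
    rw [Real.norm_eq_abs, Real.norm_eq_abs, smul_eq_mul, abs_le]
    have h5 := abs_le.1 h4
    constructor <;> nlinarith [h5.1, h5.2, mul_nonneg hc.le (abs_nonneg (t - s))]
  · rw [← Set.uIcc_of_le hab] at hanti
    exact hanti.intervalIntegrable

end Measure

/-! ### The clipped objective and its supergradient -/

section Clipped

variable {X ι : Type} [Fintype X] [DecidableEq X] {f : ι → Finset X → ℝ} {M : ℝ}

/-- Monotone submodular functions that vanish on the empty set and are at most `M` on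
singletons. -/
structure IsBoundedFamily (f : ι → Finset X → ℝ) (M : ℝ) : Prop where
  submodular : ∀ i, IsSubmodular (f i)
  monotone : ∀ i, Monotone (f i)
  map_empty : ∀ i, f i ∅ = 0
  singleton_le : ∀ i j, f i {j} ≤ M

omit [Fintype X] [DecidableEq X] in
theorem clip_mem_unitCube {y : X → ℝ} (hy : 0 ≤ y) : clip y ∈ unitCube X :=
  ⟨fun j => le_min (hy j) zero_le_one, fun _ => min_le_right _ _⟩

omit [Fintype X] [DecidableEq X] in
theorem clip_mono : Monotone (clip : (X → ℝ) → X → ℝ) := fun _ _ h j =>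
  min_le_min_right 1 (h j)

omit [Fintype X] [DecidableEq X] in
theorem clip_of_mem {x : X → ℝ} (hx : x ∈ unitCube X) : clip x = x :=
  funext fun j => min_eq_left (hx.2 j)

omit [Fintype X] [DecidableEq X] in
theorem continuous_clip : Continuous (clip : (X → ℝ) → X → ℝ) :=
  continuous_pi fun j => (continuous_apply j).min continuous_const

/-- The gradient of `F_i` at `y ∧ 1`, where `i` is the best response, with the entries at the
coordinates at which `y` exceeds `1` set to zero. -/
noncomputable def ascent (bri : BestResponseOracle f) (y : X → ℝ) (j : X) : ℝ :=
  if y j ≤ 1 then multilinearExt (marginal (f (bri.answer (clip y))) j) (clip y) else 0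

variable (bri : BestResponseOracle f)

theorem ascent_nonneg (hf : IsBoundedFamily f M) {y : X → ℝ} (hy : 0 ≤ y) (j : X) :
    0 ≤ ascent bri y j := by
  unfold ascent
  split_ifs
  · exact multilinearExt_marginal_nonneg (hf.monotone _) j (clip_mem_unitCube hy)
  · exact le_rfl

theorem ascent_le (hf : IsBoundedFamily f M) (hM : 0 ≤ M) {y : X → ℝ} (hy : 0 ≤ y) (j : X) :
    ascent bri y j ≤ M := by
  unfold ascent
  split_ifs
  · exact (multilinearExt_marginal_le (hf.submodular _) (hf.map_empty _) j
      (clip_mem_unitCube hy)).trans (hf.singleton_le _ j)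
  · exact hM

theorem measurable_ascent [Fintype ι] (j : X) : Measurable fun y => ascent bri y j := by
  classical
  have h : (fun y => ascent bri y j) = fun y => ∑ i : ι,
      {y : X → ℝ | bri.answer (clip y) = i}.indicator
        (fun y => if y j ≤ 1 then multilinearExt (marginal (f i) j) (clip y) else 0) y := by
    funext y
    rw [Finset.sum_eq_single (bri.answer (clip y))]
    · rw [Set.indicator_of_mem (by simp)]; rfl
    · intro i _ hi
      exact Set.indicator_of_notMem (fun h => hi h.symm) _
    · simp
  rw [h]
  refine Finset.measurable_sum _ fun i _ => Measurable.indicator ?_ ?_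
  · exact Measurable.ite (measurableSet_le (measurable_pi_apply j) measurable_const)
      ((continuous_multilinearExt _).comp continuous_clip).measurable measurable_const
  · exact continuous_clip.measurable (bri.measurableSet_answer i)

variable [Fintype ι] [Nonempty ι]

theorem minExt_le (f : ι → Finset X → ℝ) (i : ι) (x : X → ℝ) :
    minExt f x ≤ multilinearExt (f i) x :=
  Finset.inf'_le _ (Finset.mem_univ i)

theorem minExt_eq {x : X → ℝ} (hx : x ∈ unitCube X) :
    minExt f x = multilinearExt (f (bri.answer x)) x :=
  le_antisymm (minExt_le f _ x) (Finset.le_inf' _ _ fun i _ => bri.answer_le x hx i)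

theorem continuous_minExt (f : ι → Finset X → ℝ) : Continuous (minExt f) :=
  Continuous.finset_inf'_apply _ fun i _ => continuous_multilinearExt (f i)

theorem minExt_mono (hf : IsBoundedFamily f M) {a b : X → ℝ} (ha : a ∈ unitCube X)
    (hb : b ∈ unitCube X) (hab : a ≤ b) : minExt f a ≤ minExt f b :=
  Finset.le_inf' _ _ fun i _ => (minExt_le f i a).trans
    (multilinearExt_mono (hf.monotone i) ha hb hab)

omit [Fintype X] [DecidableEq X] in
theorem zero_mem_unitCube : (0 : X → ℝ) ∈ unitCube X := ⟨le_rfl, zero_le_one⟩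

theorem minExt_zero (hf : IsBoundedFamily f M) : minExt f 0 = 0 := by
  simp [minExt, multilinearExt_zero, hf.map_empty]

theorem minExt_nonneg (hf : IsBoundedFamily f M) {x : X → ℝ} (hx : x ∈ unitCube X) :
    0 ≤ minExt f x := by
  have := minExt_mono hf zero_mem_unitCube hx hx.1
  rwa [minExt_zero hf] at this

/-- `minExt f` is Lipschitz for the `ℓ_1` norm along nonnegative directions. -/
theorem minExt_le_add (hf : IsBoundedFamily f M) {a b : X → ℝ} (ha : a ∈ unitCube X)
    (hb : b ∈ unitCube X) (hab : a ≤ b) : minExt f b ≤ minExt f a + M * ∑ j, (b j - a j) := by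
  obtain ⟨i, -, hi⟩ := Finset.exists_mem_eq_inf' (Finset.univ_nonempty (α := ι))
    (fun i => multilinearExt (f i) a)
  have h1 := multilinearExt_le_add_sum (hf.submodular i) ha hb hab
  have h2 : ∑ j, multilinearExt (marginal (f i) j) a * (b j - a j) ≤ M * ∑ j, (b j - a j) := by
    rw [Finset.mul_sum]
    exact Finset.sum_le_sum fun j _ => mul_le_mul_of_nonneg_right
      ((multilinearExt_marginal_le (hf.submodular i) (hf.map_empty i) j ha).trans
        (hf.singleton_le i j)) (sub_nonneg.2 (hab j))
  have h3 : minExt f a = multilinearExt (f i) a := hi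
  linarith [minExt_le f i b]

/-- The objective `y ↦ G(y ∧ 1)`. -/
noncomputable def clippedExt (f : ι → Finset X → ℝ) (y : X → ℝ) : ℝ := minExt f (clip y)

theorem continuous_clippedExt (f : ι → Finset X → ℝ) : Continuous (clippedExt f) :=
  (continuous_minExt f).comp continuous_clip

theorem clippedExt_nonneg (hf : IsBoundedFamily f M) {y : X → ℝ} (hy : 0 ≤ y) :
    0 ≤ clippedExt f y := minExt_nonneg hf (clip_mem_unitCube hy)

theorem clippedExt_mono (hf : IsBoundedFamily f M) {a b : X → ℝ} (ha : 0 ≤ a) (hab : a ≤ b) :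
    clippedExt f a ≤ clippedExt f b :=
  minExt_mono hf (clip_mem_unitCube ha) (clip_mem_unitCube (ha.trans hab)) (clip_mono hab)

theorem clippedExt_le_add (hf : IsBoundedFamily f M) (hM : 0 ≤ M) {a b : X → ℝ} (ha : 0 ≤ a)
    (hab : a ≤ b) : clippedExt f b ≤ clippedExt f a + M * ∑ j, (b j - a j) := by
  refine (minExt_le_add hf (clip_mem_unitCube ha) (clip_mem_unitCube (ha.trans hab))
    (clip_mono hab)).trans ?_
  have : ∑ j, (clip b j - clip a j) ≤ ∑ j, (b j - a j) := Finset.sum_le_sum fun j _ => by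
    have := hab j
    simp only [clip]
    rcases min_cases (b j) 1 with h | h <;> rcases min_cases (a j) 1 with h' | h' <;> linarith
  have := mul_le_mul_of_nonneg_left this hM
  unfold clippedExt
  linarith

theorem clippedExt_le (hf : IsBoundedFamily f M) (hM : 0 ≤ M) {y : X → ℝ} (hy : 0 ≤ y) :
    clippedExt f y ≤ M * Fintype.card X := by
  have h := minExt_le_add hf zero_mem_unitCube (clip_mem_unitCube hy) (clip_mem_unitCube hy).1
  rw [minExt_zero hf, zero_add] at h
  refine h.trans (mul_le_mul_of_nonneg_left ?_ hM)
  calc ∑ j, (clip y j - (0 : X → ℝ) j) ≤ ∑ _j : X, (1 : ℝ) :=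
        Finset.sum_le_sum fun j _ => by simpa using (clip_mem_unitCube hy).2 j
    _ = _ := by simp

/-- Take the best response `i` at the far end: `G` equals `F_i` there and is at most `F_i` at the
near end, so the concavity of `F_i` suffices. Masking only discards nonnegative terms. -/
theorem clippedExt_add_ascent_le (hf : IsBoundedFamily f M) {y h : X → ℝ} (hy : 0 ≤ y)
    (hh : 0 ≤ h) : clippedExt f y + ∑ j, ascent bri (y + h) j * h j ≤ clippedExt f (y + h) := by
  have hyh : 0 ≤ y + h := add_nonneg hy hh
  have ha := clip_mem_unitCube hy
  have hb := clip_mem_unitCube hyh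
  have hab : clip y ≤ clip (y + h) := clip_mono (le_add_of_nonneg_right hh)
  set i := bri.answer (clip (y + h))
  have h1 := multilinearExt_add_sum_le (hf.submodular i) ha hb hab
  have h2 : clippedExt f (y + h) = multilinearExt (f i) (clip (y + h)) := minExt_eq bri hb
  have h3 : clippedExt f y ≤ multilinearExt (f i) (clip y) := minExt_le f i _
  have h4 : ∑ j, ascent bri (y + h) j * h j ≤
      ∑ j, multilinearExt (marginal (f i) j) (clip (y + h)) * (clip (y + h) j - clip y j) := by
    refine Finset.sum_le_sum fun j _ => ?_
    have hnn := multilinearExt_marginal_nonneg (hf.monotone i) j hb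
    have hhj := hh j
    simp only [Pi.zero_apply] at hhj
    unfold ascent
    split_ifs with hj
    · refine mul_le_mul_of_nonneg_left ?_ hnn
      simp only [Pi.add_apply] at hj
      simp only [clip, Pi.add_apply]
      rw [min_eq_left hj, min_eq_left (by linarith)]
      linarith
    · rw [zero_mul]
      exact mul_nonneg hnn (sub_nonneg.2 (hab j))
  linarith

/-- Pass from `w` to `clip y ⊔ w` by monotonicity; from `clip y` this is reached in a nonnegative
direction that is at most `w` and vanishes at the masked coordinates. -/
theorem le_clippedExt_add_ascent (hf : IsBoundedFamily f M) {y w : X → ℝ} (hy : 0 ≤ y)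
    (hw : w ∈ unitCube X) :
    minExt f w ≤ clippedExt f y + ∑ j, ascent bri y j * w j := by
  have hq := clip_mem_unitCube hy
  have hqw : clip y ⊔ w ∈ unitCube X :=
    ⟨hq.1.trans le_sup_left, sup_le hq.2 hw.2⟩
  set i := bri.answer (clip y)
  have h1 := multilinearExt_le_add_sum (hf.submodular i) hq hqw le_sup_left
  have h2 : clippedExt f y = multilinearExt (f i) (clip y) := minExt_eq bri hq
  have h3 : minExt f w ≤ multilinearExt (f i) (clip y ⊔ w) :=
    (minExt_le f i w).trans (multilinearExt_mono (hf.monotone i) hw hqw le_sup_right)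
  have h4 : ∑ j, multilinearExt (marginal (f i) j) (clip y) * ((clip y ⊔ w) j - clip y j) ≤
      ∑ j, ascent bri y j * w j := by
    refine Finset.sum_le_sum fun j _ => ?_
    have hnn := multilinearExt_marginal_nonneg (hf.monotone i) j hq
    have h5 := hq.1 j
    have h6 := hw.1 j
    simp only [Pi.zero_apply] at h5 h6
    unfold ascent
    split_ifs with hj
    · refine mul_le_mul_of_nonneg_left ?_ hnn
      rw [Pi.sup_apply]
      rcases max_cases (clip y j) (w j) with h | h <;> linarith
    · have hc : clip y j = 1 := min_eq_right (not_le.1 hj).le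
      have : (clip y ⊔ w) j = 1 := by
        rw [Pi.sup_apply, hc]; exact max_eq_left (hw.2 j)
      rw [this, hc]
      simp
  linarith

/-- In a single coordinate `F_i` is affine, so the supergradient inequality holds in both
directions, as `integral_supergradient` requires. -/
theorem clippedExt_update_le (hf : IsBoundedFamily f M) {y : X → ℝ} (hy : 0 ≤ y) (j : X) (t : ℝ) :
    clippedExt f (Function.update y j t) ≤
      clippedExt f y + ascent bri y j * (t - y j) := by
  have hq := clip_mem_unitCube hy
  set i := bri.answer (clip y) with hi
  have hu : clip (Function.update y j t) = Function.update (clip y) j (min t 1) := by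
    funext l
    by_cases h : l = j
    · subst h; simp [clip]
    · simp [clip, h]
  have h1 := multilinearExt_update_sub (f i) (clip y) j (min t 1)
  have h2 : clippedExt f y = multilinearExt (f i) (clip y) := minExt_eq bri hq
  have h3 : clippedExt f (Function.update y j t) ≤
      multilinearExt (f i) (Function.update (clip y) j (min t 1)) := by
    rw [clippedExt, hu]; exact minExt_le f i _
  have hnn := multilinearExt_marginal_nonneg (hf.monotone i) j hq
  have h4 : (min t 1 - clip y j) * multilinearExt (marginal (f i) j) (clip y) ≤
      ascent bri y j * (t - y j) := by
    unfold ascent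
    split_ifs with hj
    · rw [mul_comm, ← hi]
      refine mul_le_mul_of_nonneg_left ?_ hnn
      simp only [clip]
      rw [min_eq_left hj]
      linarith [min_le_left t 1]
    · have hc : clip y j = 1 := min_eq_right (not_le.1 hj).le
      rw [zero_mul, hc]
      exact mul_nonpos_of_nonpos_of_nonneg (by linarith [min_le_right t 1]) hnn
  linarith

end Clipped

/-! ### Smoothing -/

section Smoothing

variable {X ι : Type} [Fintype X] [DecidableEq X] [Fintype ι] [Nonempty ι]
  {f : ι → Finset X → ℝ} {M u : ℝ} (bri : BestResponseOracle f)

/-- The objective averaged over the perturbation. -/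
noncomputable def smoothedExt (f : ι → Finset X → ℝ) (u : ℝ) (x : X → ℝ) : ℝ :=
  ∫ z, clippedExt f (x + z) ∂uniformNoise X u

/-- The supergradient averaged over the perturbation. -/
noncomputable def meanAscent (bri : BestResponseOracle f) (u : ℝ) (x : X → ℝ) (j : X) : ℝ :=
  ∫ z, ascent bri (x + z) j ∂uniformNoise X u

omit [Fintype X] [DecidableEq X] in
theorem add_nonneg_of_abs_le {x z : X → ℝ} (hx : ∀ j, u ≤ x j) (hz : ∀ j, |z j| ≤ u) :
    0 ≤ x + z := fun j => by
  have := (abs_le.1 (hz j)).1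
  have := hx j
  simp only [Pi.zero_apply, Pi.add_apply]
  linarith

theorem integrable_clippedExt (hf : IsBoundedFamily f M) (hM : 0 ≤ M) (hu : 0 < u) {x : X → ℝ}
    (hx : ∀ j, u ≤ x j) : Integrable (fun z => clippedExt f (x + z)) (uniformNoise X u) := by
  have := isProbabilityMeasure_uniformNoise X hu
  refine Integrable.of_mem_Icc 0 (M * Fintype.card X)
    ((continuous_clippedExt f).comp (by fun_prop)).aemeasurable ?_
  filter_upwards [ae_uniformNoise X u] with z hz
  have := add_nonneg_of_abs_le hx hz
  exact ⟨clippedExt_nonneg hf this, clippedExt_le hf hM this⟩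

omit [Nonempty ι] in
theorem integrable_ascent (hf : IsBoundedFamily f M) (hM : 0 ≤ M) (hu : 0 < u) {x : X → ℝ}
    (hx : ∀ j, u ≤ x j) (j : X) :
    Integrable (fun z => ascent bri (x + z) j) (uniformNoise X u) := by
  have := isProbabilityMeasure_uniformNoise X hu
  refine Integrable.of_mem_Icc 0 M
    ((measurable_ascent bri j).comp (by fun_prop)).aemeasurable ?_
  filter_upwards [ae_uniformNoise X u] with z hz
  have := add_nonneg_of_abs_le hx hz
  exact ⟨ascent_nonneg bri hf this j, ascent_le bri hf hM this j⟩

theorem le_smoothedExt_add (hf : IsBoundedFamily f M) (hM : 0 ≤ M) (hu : 0 < u) {x w : X → ℝ}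
    (hx : ∀ j, u ≤ x j) (hw : w ∈ unitCube X) :
    minExt f w ≤ smoothedExt f u x + ∑ j, meanAscent bri u x j * w j := by
  have := isProbabilityMeasure_uniformNoise X hu
  have hi := fun j => (integrable_ascent bri hf hM hu hx j).mul_const (w j)
  calc minExt f w = ∫ _z, minExt f w ∂uniformNoise X u := by simp
    _ ≤ ∫ z, (clippedExt f (x + z) + ∑ j, ascent bri (x + z) j * w j) ∂uniformNoise X u := by
        refine integral_mono_ae (integrable_const _) ((integrable_clippedExt hf hM hu hx).add
          (integrable_finsetSum _ fun j _ => hi j)) ?_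
        filter_upwards [ae_uniformNoise X u] with z hz
        exact le_clippedExt_add_ascent bri hf (add_nonneg_of_abs_le hx hz) hw
    _ = _ := by
        rw [integral_add (integrable_clippedExt hf hM hu hx)
          (integrable_finsetSum _ fun j _ => hi j), integral_finsetSum _ fun j _ => hi j]
        simp only [integral_mul_const, smoothedExt, meanAscent]

theorem smoothedExt_add_le (hf : IsBoundedFamily f M) (hM : 0 ≤ M) (hu : 0 < u) {x h : X → ℝ}
    (hx : ∀ j, u ≤ x j) (hh : 0 ≤ h) :
    smoothedExt f u x + ∑ j, meanAscent bri u (x + h) j * h j ≤ smoothedExt f u (x + h) := by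
  have := isProbabilityMeasure_uniformNoise X hu
  have hxh : ∀ j, u ≤ (x + h) j := fun j => (hx j).trans (le_add_of_nonneg_right (hh j))
  have hi := fun j => (integrable_ascent bri hf hM hu hxh j).mul_const (h j)
  have hlin : smoothedExt f u x + ∑ j, meanAscent bri u (x + h) j * h j =
      ∫ z, (clippedExt f (x + z) + ∑ j, ascent bri (x + h + z) j * h j) ∂uniformNoise X u := by
    rw [integral_add (integrable_clippedExt hf hM hu hx)
      (integrable_finsetSum _ fun j _ => hi j), integral_finsetSum _ fun j _ => hi j]
    simp only [integral_mul_const, smoothedExt, meanAscent]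
  rw [hlin]
  refine integral_mono_ae ((integrable_clippedExt hf hM hu hx).add
    (integrable_finsetSum _ fun j _ => hi j)) (integrable_clippedExt hf hM hu hxh) ?_
  filter_upwards [ae_uniformNoise X u] with z hz
  have := clippedExt_add_ascent_le bri hf (add_nonneg_of_abs_le hx hz) hh
  rwa [add_right_comm] at this

omit [Fintype X] in
theorem abs_update_le {z : X → ℝ} (hz : ∀ j, |z j| ≤ u) (j : X) {s : ℝ} (hs : |s| ≤ u) (l : X) :
    |Function.update z j s l| ≤ u := by
  by_cases h : l = j
  · subst h; simpa using hs
  · simpa [h] using hz l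

/-- With the other noise coordinates fixed, `ascent` in coordinate `j` is a supergradient of a
function of one variable, so its integral telescopes to boundary values. -/
theorem meanAscent_eq (hf : IsBoundedFamily f M) (hM : 0 ≤ M) (hu : 0 < u) {x : X → ℝ}
    (hx : ∀ j, u ≤ x j) (j : X) :
    meanAscent bri u x j = ∫ z, (clippedExt f (x + Function.update z j u) -
      clippedExt f (x + Function.update z j (-u))) / (2 * u) ∂uniformNoise X u := by
  rw [meanAscent, integral_uniformNoise_eq hu j (integrable_ascent bri hf hM hu hx j)]
  refine integral_congr_ae ?_
  filter_upwards [ae_uniformNoise X u] with z hz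
  congr 1
  refine integral_supergradient (φ := fun s => clippedExt f (x + Function.update z j s))
    (by linarith) ?_ ?_
  · intro s hs t _
    have := clippedExt_update_le bri hf
      (add_nonneg_of_abs_le hx (abs_update_le hz j (abs_le.2 hs))) j (x j + t)
    have he : Function.update (x + Function.update z j s) j (x j + t) =
        x + Function.update z j t := by
      funext l
      by_cases h : l = j
      · subst h; simp
      · simp [h]
    rw [he] at this
    simpa using this
  · exact ((continuous_clippedExt f).comp (by fun_prop)).continuousOn

theorem integrable_clippedExt_update (hf : IsBoundedFamily f M) (hM : 0 ≤ M) (hu : 0 < u)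
    {x : X → ℝ} (hx : ∀ j, u ≤ x j) (j : X) {s : ℝ} (hs : |s| ≤ u) :
    Integrable (fun z => clippedExt f (x + Function.update z j s)) (uniformNoise X u) := by
  have := isProbabilityMeasure_uniformNoise X hu
  refine Integrable.of_mem_Icc 0 (M * Fintype.card X)
    ((continuous_clippedExt f).comp (by fun_prop)).aemeasurable ?_
  filter_upwards [ae_uniformNoise X u] with z hz
  have := add_nonneg_of_abs_le hx (abs_update_le hz j hs)
  exact ⟨clippedExt_nonneg hf this, clippedExt_le hf hM this⟩

/-- The averaged supergradient is Lipschitz. -/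
theorem meanAscent_le_add (hf : IsBoundedFamily f M) (hM : 0 ≤ M) (hu : 0 < u) {x h : X → ℝ}
    (hx : ∀ j, u ≤ x j) (hh : 0 ≤ h) (j : X) :
    meanAscent bri u x j ≤ meanAscent bri u (x + h) j + M / u * ∑ l, h l := by
  have := isProbabilityMeasure_uniformNoise X hu
  have hxh : ∀ j, u ≤ (x + h) j := fun j => (hx j).trans (le_add_of_nonneg_right (hh j))
  have hu1 : |u| ≤ u := (abs_of_pos hu).le
  have hu2 : |-u| ≤ u := by rw [abs_neg]; exact hu1
  have hi : ∀ {y : X → ℝ}, (∀ j, u ≤ y j) → Integrable (fun z =>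
      (clippedExt f (y + Function.update z j u) -
        clippedExt f (y + Function.update z j (-u))) / (2 * u)) (uniformNoise X u) := fun hy =>
    ((integrable_clippedExt_update hf hM hu hy j hu1).sub
      (integrable_clippedExt_update hf hM hu hy j hu2)).div_const _
  rw [meanAscent_eq bri hf hM hu hx, meanAscent_eq bri hf hM hu hxh]
  have hc : M / u * ∑ l, h l = ∫ _z, M / u * ∑ l, h l ∂uniformNoise X u := by simp
  rw [hc, ← integral_add (hi hxh) (integrable_const _)]
  refine integral_mono_ae (hi hx) ((hi hxh).add (integrable_const _)) ?_
  filter_upwards [ae_uniformNoise X u] with z hz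
  have h1 := add_nonneg_of_abs_le hx (abs_update_le hz j hu1)
  have h2 := add_nonneg_of_abs_le hx (abs_update_le hz j hu2)
  -- Monotonicity handles the endpoint `u` and the `ℓ_1` Lipschitz bound the endpoint `-u`. This
  -- would give `M / (2 * u)`; a factor of `2` is given away.
  have h3 := clippedExt_mono hf h1 (le_add_of_nonneg_right hh)
  have h4 := clippedExt_le_add hf hM h2 (le_add_of_nonneg_right hh)
  have hM' : 0 ≤ M * ∑ l, h l := mul_nonneg hM (Finset.sum_nonneg fun l _ => hh l)
  rw [add_right_comm] at h3 h4
  simp only [Pi.add_apply, add_sub_add_right_eq_sub, add_sub_cancel_left] at h4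
  have h5 : M / u * ∑ l, h l = 2 * (M * ∑ l, h l) / (2 * u) := by field_simp
  rw [h5, ← add_div]
  gcongr
  linarith

/-- Progress along a nonnegative direction. -/
theorem smoothedExt_add_ge (hf : IsBoundedFamily f M) (hM : 0 ≤ M) (hu : 0 < u) {x h : X → ℝ}
    (hx : ∀ j, u ≤ x j) (hh : 0 ≤ h) :
    smoothedExt f u x + ∑ j, meanAscent bri u x j * h j - M / u * (∑ j, h j) ^ 2 ≤
      smoothedExt f u (x + h) := by
  have h1 := smoothedExt_add_le bri hf hM hu hx hh
  have h2 : ∑ j, meanAscent bri u x j * h j ≤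
      ∑ j, meanAscent bri u (x + h) j * h j + M / u * (∑ j, h j) ^ 2 := by
    rw [sq, ← mul_assoc, Finset.mul_sum, ← Finset.sum_add_distrib]
    refine Finset.sum_le_sum fun j _ => ?_
    rw [← add_mul]
    exact mul_le_mul_of_nonneg_right (meanAscent_le_add bri hf hM hu hx hh j) (hh j)
  linarith

theorem smoothedExt_nonneg (hf : IsBoundedFamily f M) {x : X → ℝ} (hx : ∀ j, u ≤ x j) :
    0 ≤ smoothedExt f u x := by
  refine integral_nonneg_of_ae ?_
  filter_upwards [ae_uniformNoise X u] with z hz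
  exact clippedExt_nonneg hf (add_nonneg_of_abs_le hx hz)

/-- The shift by `u` plus noise raises each coordinate by an amount between `0` and `2 * u`. -/
theorem smoothedExt_le (hf : IsBoundedFamily f M) (hM : 0 ≤ M) (hu : 0 < u) {x : X → ℝ}
    (hx : x ∈ unitCube X) :
    smoothedExt f u (fun j => x j + u) ≤ minExt f x + 2 * u * M * Fintype.card X := by
  have := isProbabilityMeasure_uniformNoise X hu
  have hxu : ∀ j, u ≤ x j + u := fun j => le_add_of_nonneg_left (hx.1 j)
  have hc : minExt f x + 2 * u * M * Fintype.card X =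
      ∫ _z, (minExt f x + 2 * u * M * Fintype.card X) ∂uniformNoise X u := by simp
  rw [hc]
  refine integral_mono_ae (integrable_clippedExt hf hM hu hxu) (integrable_const _) ?_
  filter_upwards [ae_uniformNoise X u] with z hz
  have h1 : x ≤ (fun j => x j + u) + z := fun j => by
    have := (abs_le.1 (hz j)).1
    simp only [Pi.add_apply]; linarith
  have h2 := clippedExt_le_add hf hM hx.1 h1
  have h3 : ∑ j, (((fun j => x j + u) + z) j - x j) ≤ ∑ _j : X, 2 * u :=
    Finset.sum_le_sum fun j _ => by
      have := (abs_le.1 (hz j)).2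
      simp only [Pi.add_apply]; linarith
  have h4 := mul_le_mul_of_nonneg_left h3 hM
  simp only [Finset.sum_const, Finset.card_univ, nsmul_eq_mul] at h4
  have h5 : clippedExt f x = minExt f x := by rw [clippedExt, clip_of_mem hx]
  rw [h5] at h2
  linarith

end Smoothing

/-! ### Concentration of an average of bounded samples -/

section Concentration

theorem hoeffding_pi_ge {α : Type*} [MeasurableSpace α] (ν : Measure α) [IsProbabilityMeasure ν]
    {Y : α → ℝ} (hY : Measurable Y) {M : ℝ} (hM : 0 < M) (hb : ∀ᵐ a ∂ν, |Y a| ≤ M)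
    {c : ℕ} (hc : 0 < c) {e : ℝ} (he : 0 ≤ e) :
    (Measure.pi fun _ : Fin c => ν).real {s | e * c ≤ ∑ t, (Y (s t) - ∫ a, Y a ∂ν)} ≤
      Real.exp (-(c * e ^ 2 / (2 * M ^ 2))) := by
  -- A variable confined to `[-M, M]` has variance proxy `M ^ 2`; for `c` independent copies and
  -- deviation `e * c` the exponent is `(e * c) ^ 2 / (2 * c * M ^ 2)`.
  have hsub := ProbabilityTheory.hasSubgaussianMGF_of_mem_Icc (a := -M) (b := M) hY.aemeasurable
    (hb.mono fun a ha => abs_le.1 ha)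
  have hind := ProbabilityTheory.iIndepFun_pi (μ := fun _ : Fin c => ν)
    (X := fun _ a => Y a - ∫ a, Y a ∂ν) fun _ => (hY.sub_const _).aemeasurable
  have h := ProbabilityTheory.HasSubgaussianMGF.measure_sum_ge_le_of_iIndepFun hind
    (c := fun _ => (‖M - -M‖₊ / 2) ^ 2) (s := Finset.univ) (fun t _ => by
      have hmp := measurePreserving_eval (fun _ : Fin c => ν) t
      exact ProbabilityTheory.HasSubgaussianMGF.of_map (Y := Function.eval t)
        hmp.measurable.aemeasurable (by rw [hmp.map_eq]; exact hsub))
    (ε := e * c) (by positivity)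
  refine h.trans (le_of_eq ?_)
  congr 1
  have hn : ‖M - -M‖ = 2 * M := by
    rw [Real.norm_eq_abs, abs_of_pos (by linarith)]; ring
  have hc' : (0 : ℝ) < c := by exact_mod_cast hc
  push_cast
  rw [hn]
  simp only [Finset.sum_const, Finset.card_univ, Fintype.card_fin, nsmul_eq_mul]
  field_simp

theorem hoeffding_pi {α : Type*} [MeasurableSpace α] (ν : Measure α) [IsProbabilityMeasure ν]
    {Y : α → ℝ} (hY : Measurable Y) {M : ℝ} (hM : 0 < M) (hb : ∀ᵐ a ∂ν, |Y a| ≤ M)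
    {c : ℕ} (hc : 0 < c) {e : ℝ} (he : 0 ≤ e) :
    (Measure.pi fun _ : Fin c => ν).real {s | e ≤ |(∑ t, Y (s t)) / c - ∫ a, Y a ∂ν|} ≤
      2 * Real.exp (-(c * e ^ 2 / (2 * M ^ 2))) := by
  have h1 := hoeffding_pi_ge ν hY hM hb hc he
  have h2 := hoeffding_pi_ge ν (Y := fun a => -Y a) hY.neg hM (by simpa using hb) hc he
  have hc' : (0 : ℝ) < c := by exact_mod_cast hc
  refine (measureReal_mono (s₂ := {s | e * c ≤ ∑ t, (Y (s t) - ∫ a, Y a ∂ν)} ∪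
    {s | e * c ≤ ∑ t, (-Y (s t) - ∫ a, -Y a ∂ν)}) ?_).trans
    ((measureReal_union_le _ _).trans (by linarith))
  intro s hs
  rw [Set.mem_ofPred_eq, le_abs] at hs
  simp only [Set.mem_union, Set.mem_ofPred_eq, Finset.sum_sub_distrib, Finset.sum_neg_distrib,
    Finset.sum_const, Finset.card_univ, Fintype.card_fin, nsmul_eq_mul, integral_neg]
  refine hs.imp (fun h => ?_) fun h => ?_
  · have := mul_le_mul_of_nonneg_right h hc'.le
    rw [sub_mul, div_mul_cancel₀ _ hc'.ne'] at this
    linarith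
  · have := mul_le_mul_of_nonneg_right h hc'.le
    rw [neg_mul, sub_mul, div_mul_cancel₀ _ hc'.ne'] at this
    linarith

end Concentration

/-! ### Gradient samples -/

section Samples

variable {X ι : Type} [Fintype X] [DecidableEq X] {f : ι → Finset X → ℝ} {M u : ℝ}
  {Ω : Type*} [MeasurableSpace Ω] {Q : Measure Ω}
  (bri : BestResponseOracle f) (fo : FirstOrderOracle f M Q)

theorem sampleGradient_val (x : X → ℝ) (s : (X → ℝ) × Ω) (j : X) :
    (sampleGradient bri fo x s).val j =
      if (x + s.1) j ≤ 1 then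
        fo.answer (bri.answer (clip (x + s.1))) (clip (x + s.1)) s.2 j else 0 := rfl

/-- Measurability of the first-order oracle is given only for each fixed index, so the sample is
split over the finitely many values of the best response. -/
theorem measurable_sampleGradient [Fintype ι] (j : X) :
    Measurable fun p : (X → ℝ) × ((X → ℝ) × Ω) => (sampleGradient bri fo p.1 p.2).val j := by
  classical
  have hadd : Measurable fun p : (X → ℝ) × ((X → ℝ) × Ω) => p.1 + p.2.1 := by fun_prop
  have hclip : Measurable fun p : (X → ℝ) × ((X → ℝ) × Ω) => clip (p.1 + p.2.1) :=
    continuous_clip.measurable.comp hadd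
  have h : (fun p : (X → ℝ) × ((X → ℝ) × Ω) => (sampleGradient bri fo p.1 p.2).val j) =
      fun p => ∑ i : ι, {p : (X → ℝ) × ((X → ℝ) × Ω) |
        bri.answer (clip (p.1 + p.2.1)) = i}.indicator
          (fun p => if (p.1 + p.2.1) j ≤ 1 then fo.answer i (clip (p.1 + p.2.1)) p.2.2 j else 0)
          p := by
    funext p
    rw [Finset.sum_eq_single (bri.answer (clip (p.1 + p.2.1)))]
    · rw [Set.indicator_of_mem (by simp)]; rfl
    · intro i _ hi
      exact Set.indicator_of_notMem (fun h => hi h.symm) _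
    · simp
  rw [h]
  refine Finset.measurable_sum _ fun i _ => Measurable.indicator ?_ ?_
  · refine Measurable.ite (measurableSet_le ((measurable_pi_apply j).comp hadd) measurable_const)
      ?_ measurable_const
    have hg : Measurable fun p : (X → ℝ) × ((X → ℝ) × Ω) => (clip (p.1 + p.2.1), p.2.2) :=
      hclip.prodMk (by fun_prop)
    exact (measurable_pi_apply j).comp ((fo.measurable_answer i).comp hg)
  · exact hclip (bri.measurableSet_answer i)

variable [Fintype ι] [IsProbabilityMeasure Q]

theorem ae_abs_sampleGradient_le (hM : 0 ≤ M) (hu : 0 < u) {x : X → ℝ} (hx : ∀ j, u ≤ x j)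
    (j : X) :
    ∀ᵐ s ∂(uniformNoise X u).prod Q, |(sampleGradient bri fo x s).val j| ≤ M := by
  have := isProbabilityMeasure_uniformNoise X hu
  have hm : Measurable fun s : (X → ℝ) × Ω => (sampleGradient bri fo x s).val j :=
    (measurable_sampleGradient bri fo j).comp measurable_prodMk_left
  rw [Measure.ae_prod_iff_ae_ae (measurableSet_le hm.abs measurable_const)]
  filter_upwards [ae_uniformNoise X u] with z hz
  have hq := clip_mem_unitCube (add_nonneg_of_abs_le hx hz)
  filter_upwards [fo.abs_le (bri.answer (clip (x + z))) _ hq] with ω hω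
  rw [sampleGradient_val]
  split_ifs
  · exact hω j
  · simpa using hM

/-- The index and the query point depend on the perturbation alone, so the fresh oracle bits can be
averaged first. -/
theorem integral_sampleGradient (hM : 0 ≤ M) (hu : 0 < u) {x : X → ℝ} (hx : ∀ j, u ≤ x j)
    (j : X) :
    ∫ s, (sampleGradient bri fo x s).val j ∂(uniformNoise X u).prod Q = meanAscent bri u x j := by
  have := isProbabilityMeasure_uniformNoise X hu
  have hm : Measurable fun s : (X → ℝ) × Ω => (sampleGradient bri fo x s).val j :=
    (measurable_sampleGradient bri fo j).comp measurable_prodMk_left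
  have hi : Integrable (fun s => (sampleGradient bri fo x s).val j) ((uniformNoise X u).prod Q) :=
    Integrable.of_mem_Icc (-M) M hm.aemeasurable
      ((ae_abs_sampleGradient_le bri fo hM hu hx j).mono fun s hs => abs_le.1 hs)
  rw [integral_prod _ hi]
  refine integral_congr_ae ?_
  filter_upwards [ae_uniformNoise X u] with z hz
  have hq := clip_mem_unitCube (add_nonneg_of_abs_le hx hz)
  simp only [sampleGradient_val]
  unfold ascent
  split_ifs
  · rw [fo.unbiased _ _ hq, partialDeriv_multilinearExt]
  · simp

end Samples

/-! ### Running times and values of loops -/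

section Loops

theorem Timed.bind_val {α β : Type} (a : Timed α) (b : α → Timed β) :
    (a >>= b).val = (b a.val).val := rfl

theorem Timed.bind_time {α β : Type} (a : Timed α) (b : α → Timed β) :
    (a >>= b).time = a.time + (b a.val).time := rfl

theorem Timed.foldlM_val {α β : Type} (g : α → β → Timed α) (l : List β) (a : α) :
    (l.foldlM g a).val = l.foldl (fun a b => (g a b).val) a := by
  induction l generalizing a with
  | nil => rfl
  | cons b l ih => rw [List.foldlM_cons, Timed.bind_val, ih, List.foldl_cons]

theorem Timed.foldlM_time_le {α β : Type} (g : α → β → Timed α) {B : ℕ}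
    (hB : ∀ a b, (g a b).time ≤ B) (l : List β) (a : α) :
    (l.foldlM g a).time ≤ l.length * B := by
  induction l generalizing a with
  | nil => exact Nat.zero_le _
  | cons b l ih =>
    rw [List.foldlM_cons, Timed.bind_time, List.length_cons, add_mul, one_mul, add_comm]
    exact add_le_add (ih _) (hB a b)

/-- The state of a loop over `Fin K` after `m` iterations. -/
def loopState {K : ℕ} {α : Type*} (g : α → Fin K → α) (a : α) : ℕ → α
  | 0 => a
  | m + 1 => if h : m < K then g (loopState g a m) ⟨m, h⟩ else loopState g a m

theorem loopState_succ {K : ℕ} {α : Type*} (g : α → Fin K → α) (a : α) (l : Fin K) :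
    loopState g a (l + 1) = g (loopState g a l) l := by
  rw [loopState, dif_pos l.2]

theorem foldl_finRange {K : ℕ} {α : Type*} (g : α → Fin K → α) (a : α) :
    (List.finRange K).foldl g a = loopState g a K := by
  have h : ∀ m ≤ K, ((List.finRange K).take m).foldl g a = loopState g a m := by
    intro m
    induction m with
    | zero => intro _; rfl
    | succ m ih =>
      intro hm
      rw [List.take_succ_eq_append_getElem (by simpa using hm), List.foldl_append, ih (by omega),
        loopState, dif_pos (by omega)]
      simp
  have := h K le_rfl
  rwa [List.take_of_length_le (by simp)] at this

theorem foldl_add {X β : Type} (l : List β) (a : X → ℝ) (g : β → X → ℝ) (j : X) :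
    l.foldl (fun acc t j => acc j + g t j) a j = a j + (l.map fun t => g t j).sum := by
  induction l generalizing a with
  | nil => simp
  | cons b l ih => rw [List.foldl_cons, ih, List.map_cons, List.sum_cons, add_assoc]

end Loops

/-! ### The iterates of Stochastic Frank-Wolfe -/

section Iterates

variable {X ι : Type} [Fintype X] [DecidableEq X] {f : ι → Finset X → ℝ} {M : ℝ}
  {Ω : Type*} [MeasurableSpace Ω] {Q : Measure Ω} {P : Set (X → ℝ)}
  (lo : LinearOracle P) (bri : BestResponseOracle f) (fo : FirstOrderOracle f M Q)

theorem averageGradient_val {c : ℕ} (s : Fin c → (X → ℝ) × Ω) (x : X → ℝ) (j : X) :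
    (averageGradient bri fo s x).val j =
      (∑ t, (sampleGradient bri fo x (s t)).val j) / c := by
  have h : (averageGradient bri fo s x).val j =
      ((List.finRange c).foldlM (m := Timed) (fun acc t => do
        tick
        let g ← sampleGradient bri fo x (s t)
        addT acc g) (fun _ : X => (0 : ℝ))).val j / c := rfl
  rw [h, Timed.foldlM_val]
  congr 1
  refine (foldl_add _ _ (fun t => (sampleGradient bri fo x (s t)).val) j).trans ?_
  rw [zero_add, Fin.sum_univ_def]

/-- The answer of the linear optimization oracle in an iteration from `x` with samples `s`. -/
noncomputable def direction {c : ℕ} (s : Fin c → (X → ℝ) × Ω) (x : X → ℝ) : X → ℝ :=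
  lo.answer (averageGradient bri fo s x).val

/-- The point `x^m`. -/
noncomputable def iterate (u : ℝ) {K c : ℕ} (tape : Fin K → Fin c → (X → ℝ) × Ω) (m : ℕ) : X → ℝ :=
  loopState (fun x l => (frankWolfeStep lo bri fo K (tape l) x).val) (fun _ => u) m

theorem stochasticFrankWolfe_val (u : ℝ) {K c : ℕ} (tape : Fin K → Fin c → (X → ℝ) × Ω) :
    (stochasticFrankWolfe lo bri fo u K c tape).val =
      (iterate lo bri fo u tape K, fun j => iterate lo bri fo u tape K j - u) := by
  have h : (stochasticFrankWolfe lo bri fo u K c tape).val =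
      (((List.finRange K).foldlM (m := Timed) (fun x l => frankWolfeStep lo bri fo K (tape l) x)
          (fun _ : X => u)).val,
        fun j => ((List.finRange K).foldlM (m := Timed)
          (fun x l => frankWolfeStep lo bri fo K (tape l) x) (fun _ : X => u)).val j - u) := rfl
  rw [h, Timed.foldlM_val, foldl_finRange]
  rfl

theorem iterate_succ (u : ℝ) {K c : ℕ} (tape : Fin K → Fin c → (X → ℝ) × Ω) (l : Fin K) :
    iterate lo bri fo u tape (l + 1) = iterate lo bri fo u tape l +
      fun j => direction lo bri fo (tape l) (iterate lo bri fo u tape l) j / K :=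
  loopState_succ _ _ l

/-- Counting from `0`, block `l` is first read in passing from `x^l` to `x^(l+1)`. Hence `x^l` is
independent of the samples taken at it. -/
theorem iterate_update_of_le (u : ℝ) {K c : ℕ} (tape : Fin K → Fin c → (X → ℝ) × Ω) (l : Fin K)
    (s : Fin c → (X → ℝ) × Ω) {m : ℕ} (hm : m ≤ l) :
    iterate lo bri fo u (Function.update tape l s) m = iterate lo bri fo u tape m := by
  induction m with
  | zero => rfl
  | succ m ih =>
    have hmK : m < K := by omega
    have hne : (⟨m, hmK⟩ : Fin K) ≠ l := fun h => by
      have := congrArg Fin.val h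
      simp only at this
      omega
    have h1 := iterate_succ lo bri fo u tape ⟨m, hmK⟩
    have h2 := iterate_succ lo bri fo u (Function.update tape l s) ⟨m, hmK⟩
    simp only at h1 h2
    rw [h1, h2, Function.update_of_ne hne, ih (by omega)]

theorem le_iterate (hP : P ⊆ unitCube X) (u : ℝ) {K c : ℕ}
    (tape : Fin K → Fin c → (X → ℝ) × Ω) {m : ℕ} (hm : m ≤ K) (j : X) :
    u ≤ iterate lo bri fo u tape m j := by
  induction m with
  | zero => exact le_rfl
  | succ m ih =>
    have h1 := iterate_succ lo bri fo u tape ⟨m, hm⟩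
    simp only at h1
    rw [h1]
    exact (ih (by omega)).trans (le_add_of_nonneg_right
      (div_nonneg ((hP (lo.answer_mem _)).1 j) (Nat.cast_nonneg K)))

theorem iterate_sub_eq_sum (u : ℝ) {K c : ℕ} (tape : Fin K → Fin c → (X → ℝ) × Ω) :
    (fun j => iterate lo bri fo u tape K j - u) = ∑ l : Fin K,
      (1 / K : ℝ) • direction lo bri fo (tape l) (iterate lo bri fo u tape l) := by
  have h : ∀ m ≤ K, (fun j => iterate lo bri fo u tape m j - u) = ∑ i ∈ Finset.range m,
      if h : i < K then
        (1 / K : ℝ) • direction lo bri fo (tape ⟨i, h⟩) (iterate lo bri fo u tape i) else 0 := by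
    intro m
    induction m with
    | zero => intro _; funext j; simp [iterate, loopState]
    | succ m ih =>
      intro hm
      have h1 := iterate_succ lo bri fo u tape ⟨m, hm⟩
      simp only at h1
      rw [Finset.sum_range_succ, ← ih (by omega), dif_pos (by omega), h1]
      funext j
      simp only [Pi.add_apply, Pi.smul_apply, smul_eq_mul]
      ring
  rw [h K le_rfl, Finset.sum_range]
  exact Finset.sum_congr rfl fun l _ => dif_pos l.2

/-- The shifted endpoint is the average of `K` answers of the linear oracle. -/
theorem iterate_sub_mem (hP : Convex ℝ P) (u : ℝ) {K c : ℕ} (hK : 0 < K)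
    (tape : Fin K → Fin c → (X → ℝ) × Ω) : (fun j => iterate lo bri fo u tape K j - u) ∈ P := by
  rw [iterate_sub_eq_sum]
  refine hP.sum_mem (fun _ _ => by positivity) ?_ fun l _ => lo.answer_mem _
  have : (K : ℝ) ≠ 0 := by exact_mod_cast hK.ne'
  simp [this]

theorem measurable_averageGradient [Fintype ι] (c : ℕ) :
    Measurable fun p : (X → ℝ) × (Fin c → (X → ℝ) × Ω) =>
      (averageGradient bri fo p.2 p.1).val := by
  refine measurable_pi_lambda _ fun j => ?_
  simp only [averageGradient_val]
  refine (Finset.measurable_sum _ fun t _ => ?_).div_const _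
  have hg : Measurable fun p : (X → ℝ) × (Fin c → (X → ℝ) × Ω) => (p.1, p.2 t) := by fun_prop
  simpa only [Function.comp_def] using (measurable_sampleGradient bri fo j).comp hg

theorem measurable_direction [Fintype ι] (c : ℕ) :
    Measurable fun p : (X → ℝ) × (Fin c → (X → ℝ) × Ω) => direction lo bri fo p.2 p.1 :=
  lo.measurable_answer.comp (measurable_averageGradient bri fo c)

theorem measurable_iterate [Fintype ι] (u : ℝ) {K c : ℕ} {m : ℕ} (hm : m ≤ K) :
    Measurable fun tape : Fin K → Fin c → (X → ℝ) × Ω => iterate lo bri fo u tape m := by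
  induction m with
  | zero => exact measurable_const
  | succ m ih =>
    have h1 := fun tape : Fin K → Fin c → (X → ℝ) × Ω =>
      iterate_succ lo bri fo u tape ⟨m, hm⟩
    simp only at h1
    simp only [h1]
    have hi := ih (by omega)
    have hpair : Measurable fun tape : Fin K → Fin c → (X → ℝ) × Ω =>
        (iterate lo bri fo u tape m, tape ⟨m, hm⟩) :=
      hi.prodMk (measurable_pi_apply (⟨m, hm⟩ : Fin K))
    have hd : Measurable fun tape : Fin K → Fin c → (X → ℝ) × Ω =>
        direction lo bri fo (tape ⟨m, hm⟩) (iterate lo bri fo u tape m) := by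
      simpa only [Function.comp_def] using (measurable_direction lo bri fo c).comp hpair
    refine hi.add (measurable_pi_lambda _ fun j => Measurable.div_const ?_ _)
    exact measurable_pi_iff.1 hd j

/-- All vector operations are absorbed into oracle calls, since `1 ≤ n ≤ T₁` and `n ≤ T₂`. A sample
with its addition costs `5 * n + 1 + T₂ ≤ 7 * T₂`; the rest of an iteration costs `4 * n + 1 + T₁ ≤
6 * T₁`; start and end cost `2 * n`. -/
theorem stochasticFrankWolfe_time_le (u : ℝ) {K c : ℕ} (hK : 0 < K) (hc : 0 < c)
    (hX : 0 < Fintype.card X) {T₁ T₂ : ℕ}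
    (hT₁ : ∀ w, lo.time w ≤ T₁)
    (hT₂ : ∀ x ω, bri.time x + fo.time (bri.answer x) x ω ≤ T₂)
    (tape : Fin K → Fin c → (X → ℝ) × Ω) :
    (stochasticFrankWolfe lo bri fo u K c tape).time ≤ 9 * (K * T₁) + 7 * (K * c * T₂) := by
  set n := Fintype.card X with hn
  have hn1 : n ≤ T₁ := (lo.card_le_time 0).trans (hT₁ 0)
  have hn2 : n ≤ T₂ := by
    have ω : Ω := (tape ⟨0, hK⟩ ⟨0, hc⟩).2
    have := fo.card_le_time (bri.answer 0) 0 ω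
    have := hT₂ 0 ω
    omega
  have hsample : ∀ x (s : (X → ℝ) × Ω), (sampleGradient bri fo x s).time ≤ 4 * n + T₂ := by
    intro x s
    have h : (sampleGradient bri fo x s).time = n + (n + (n + (bri.time (clip (x + s.1)) +
      (fo.time (bri.answer (clip (x + s.1))) (clip (x + s.1)) s.2 + n)))) := rfl
    have := hT₂ (clip (x + s.1)) s.2
    omega
  have havg : ∀ (s : Fin c → (X → ℝ) × Ω) x,
      (averageGradient bri fo s x).time ≤ 2 * n + c * (7 * T₂) := by
    intro s x
    have h : (averageGradient bri fo s x).time = n + (((List.finRange c).foldlM (m := Timed)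
      (fun acc t => do
        tick
        let g ← sampleGradient bri fo x (s t)
        addT acc g) (fun _ : X => (0 : ℝ))).time + n) := rfl
    have h2 := Timed.foldlM_time_le (fun (acc : X → ℝ) t => do
        tick
        let g ← sampleGradient bri fo x (s t)
        addT acc g) (B := 7 * T₂) (fun acc t => by
          have h : (do
            tick
            let g ← sampleGradient bri fo x (s t)
            addT acc g : Timed (X → ℝ)).time =
              1 + ((sampleGradient bri fo x (s t)).time + n) := rfl
          have := hsample x (s t)
          omega) (List.finRange c) (fun _ : X => (0 : ℝ))
    rw [List.length_finRange] at h2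
    omega
  have hstep : ∀ x (l : Fin K),
      (frankWolfeStep lo bri fo K (tape l) x).time ≤ 6 * T₁ + c * (7 * T₂) := by
    intro x l
    have h : (frankWolfeStep lo bri fo K (tape l) x).time =
      1 + ((averageGradient bri fo (tape l) x).time +
        (lo.time (averageGradient bri fo (tape l) x).val + (n + n))) := rfl
    have := havg (tape l) x
    have := hT₁ (averageGradient bri fo (tape l) x).val
    omega
  have h : (stochasticFrankWolfe lo bri fo u K c tape).time = n + (((List.finRange K).foldlM
      (m := Timed) (fun x l => frankWolfeStep lo bri fo K (tape l) x) (fun _ : X => u)).time +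
        (n + 0)) := rfl
  have h2 := Timed.foldlM_time_le (fun x l => frankWolfeStep lo bri fo K (tape l) x) hstep
    (List.finRange K) (fun _ : X => u)
  rw [List.length_finRange] at h2
  have h3 : T₁ ≤ K * T₁ := Nat.le_mul_of_pos_left _ hK
  have h4 : K * (6 * T₁ + c * (7 * T₂)) = 6 * (K * T₁) + 7 * (K * c * T₂) := by ring
  omega

end Iterates

/-! ### The matroid polytope -/

section Polytope

variable {X : Type} [Fintype X] [DecidableEq X]

omit [Fintype X] in
theorem convex_polytope (I : Matroid X) : Convex ℝ (polytope I) := convex_convexHull ℝ _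

theorem isCompact_polytope (I : Matroid X) : IsCompact (polytope I) :=
  ((Set.toFinite _).image _).isCompact_convexHull ℝ

omit [Fintype X] in
theorem polytope_nonempty (I : Matroid X) : (polytope I).Nonempty :=
  ⟨indicatorVec ∅, subset_convexHull ℝ _ ⟨∅, by simp, rfl⟩⟩

omit [Fintype X] in
theorem polytope_subset_unitCube (I : Matroid X) : polytope I ⊆ unitCube X := by
  refine convexHull_min ?_ (convex_Icc 0 1)
  rintro _ ⟨S, -, rfl⟩
  constructor <;> intro j <;> by_cases h : j ∈ S <;> simp [indicatorVec, h]

theorem sum_le_of_mem_polytope {I : Matroid X} {k : ℕ} (hI : I.eRank = (k : ℕ∞)) {v : X → ℝ}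
    (hv : v ∈ polytope I) : ∑ j, v j ≤ k := by
  have hconv : Convex ℝ {v : X → ℝ | ∑ j, v j ≤ k} := by
    refine convex_halfSpace_le (f := fun v : X → ℝ => ∑ j, v j) ⟨fun x y => ?_, fun a x => ?_⟩ _
    · simp [Finset.sum_add_distrib]
    · simp [Finset.mul_sum]
  refine convexHull_min ?_ hconv hv
  rintro _ ⟨S, hS, rfl⟩
  have h := Matroid.Indep.encard_le_eRank hS
  rw [hI, Set.encard_coe_eq_coe_finsetCard] at h
  have h' : S.card ≤ k := by exact_mod_cast h
  simpa [indicatorVec] using h'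

end Polytope

/-! ### The deviation of the averaged samples -/

section Deviation

/-- A bound for the probability of an event that depends on the past and on a fresh sample. -/
theorem measure_adapted_le {K : ℕ} {α β : Type*} [MeasurableSpace α] [MeasurableSpace β]
    (ν : Measure α) [IsProbabilityMeasure ν] (l : Fin K) {x : (Fin K → α) → β}
    (hx : Measurable x) (hxl : ∀ tape s, x (Function.update tape l s) = x tape)
    {B : Set (β × α)} (hB : MeasurableSet B) {p : ENNReal}
    (h : ∀ tape, ν {s | (x tape, s) ∈ B} ≤ p) :
    Measure.pi (fun _ : Fin K => ν) {tape | (x tape, tape l) ∈ B} ≤ p := by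
  -- Replacing block `l` by an independent copy changes neither the law of the tape nor `x`, so
  -- Fubini reduces the claim to a fixed value of `x`.
  have hmp := measurePreserving_update_pi (fun _ : Fin K => ν) l
  have hs : MeasurableSet {tape : Fin K → α | (x tape, tape l) ∈ B} :=
    (hx.prodMk (measurable_pi_apply l)) hB
  rw [← hmp.measure_preimage hs.nullMeasurableSet, Measure.prod_apply (hmp.measurable hs)]
  calc ∫⁻ tape, ν (Prod.mk tape ⁻¹' ((fun q : (Fin K → α) × α => Function.update q.1 l q.2) ⁻¹'
          {tape : Fin K → α | (x tape, tape l) ∈ B})) ∂Measure.pi (fun _ : Fin K => ν)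
      ≤ ∫⁻ _tape, p ∂Measure.pi (fun _ : Fin K => ν) := by
        refine lintegral_mono fun tape => (le_of_eq ?_).trans (h tape)
        congr 1
        ext s
        simp [hxl]
    _ = p := by simp

variable {X ι : Type} [Fintype X] [DecidableEq X] {f : ι → Finset X → ℝ} {M u : ℝ}
  {Ω : Type*} [MeasurableSpace Ω] {Q : Measure Ω} {P : Set (X → ℝ)}
  (lo : LinearOracle P) (bri : BestResponseOracle f) (fo : FirstOrderOracle f M Q)

/-- The event that some entry of the averaged samples at `x` is off by at least `e`. -/
def deviation (u e : ℝ) (c : ℕ) : Set ((X → ℝ) × (Fin c → (X → ℝ) × Ω)) :=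
  ⋃ j, {p | e ≤ |(averageGradient bri fo p.2 p.1).val j - meanAscent bri u p.1 j|}

variable [Fintype ι]

theorem measurable_meanAscent (hu : 0 < u) (j : X) :
    Measurable fun x => meanAscent bri u x j := by
  have := isProbabilityMeasure_uniformNoise X hu
  have h : Measurable fun p : (X → ℝ) × (X → ℝ) => ascent bri (p.1 + p.2) j :=
    (measurable_ascent bri j).comp (by fun_prop)
  exact h.stronglyMeasurable.integral_prod_right'.measurable

theorem measurableSet_deviation (hu : 0 < u) (e : ℝ) (c : ℕ) :
    MeasurableSet (deviation bri fo u e c) := by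
  refine MeasurableSet.iUnion fun j => measurableSet_le measurable_const ?_
  have h1 := measurable_pi_iff.1 (measurable_averageGradient bri fo c) j
  have h2 : Measurable fun p : (X → ℝ) × (Fin c → (X → ℝ) × Ω) => meanAscent bri u p.1 j :=
    (measurable_meanAscent bri hu j).comp measurable_fst
  exact (h1.sub h2).abs

theorem measure_deviation_le [IsProbabilityMeasure Q] (hM : 0 < M) (hu : 0 < u) {x : X → ℝ}
    (hx : ∀ j, u ≤ x j) {c : ℕ} (hc : 0 < c) {e : ℝ} (he : 0 ≤ e) :
    Measure.pi (fun _ : Fin c => (uniformNoise X u).prod Q)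
        {s | (x, s) ∈ deviation bri fo u e c} ≤
      ENNReal.ofReal (Fintype.card X * (2 * Real.exp (-(c * e ^ 2 / (2 * M ^ 2))))) := by
  have := isProbabilityMeasure_uniformNoise X hu
  have h : {s | (x, s) ∈ deviation bri fo u e c} = ⋃ j, {s : Fin c → (X → ℝ) × Ω |
      e ≤ |(∑ t, (sampleGradient bri fo x (s t)).val j) / c -
        ∫ s, (sampleGradient bri fo x s).val j ∂(uniformNoise X u).prod Q|} := by
    ext s
    simp only [deviation, Set.mem_ofPred_eq, Set.mem_iUnion, averageGradient_val,
      integral_sampleGradient bri fo hM.le hu hx]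
  rw [h]
  refine (measure_iUnion_fintype_le _ _).trans ?_
  rw [ENNReal.ofReal_mul (Nat.cast_nonneg _), ENNReal.ofReal_natCast, ← nsmul_eq_mul]
  refine (Finset.sum_le_card_nsmul _ _ _ fun j _ => ?_)
  rw [← ofReal_measureReal]
  have hm := measurable_sampleGradient bri fo j
  exact ENNReal.ofReal_le_ofReal (hoeffding_pi _ (hm.comp measurable_prodMk_left) hM
    (ae_abs_sampleGradient_le bri fo hM.le hu hx j) hc he)

theorem measure_iterate_deviation_le [IsProbabilityMeasure Q] (hP : P ⊆ unitCube X) (hM : 0 < M)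
    (hu : 0 < u) {K c : ℕ} (hc : 0 < c) {e : ℝ} (he : 0 ≤ e) :
    tapeLaw X Q u K c
        (⋃ l : Fin K, {tape | (iterate lo bri fo u tape l, tape l) ∈ deviation bri fo u e c}) ≤
      ENNReal.ofReal (K * (Fintype.card X * (2 * Real.exp (-(c * e ^ 2 / (2 * M ^ 2)))))) := by
  have := isProbabilityMeasure_uniformNoise X hu
  refine (measure_iUnion_fintype_le _ _).trans ?_
  rw [ENNReal.ofReal_mul (Nat.cast_nonneg _), ENNReal.ofReal_natCast, ← nsmul_eq_mul]
  refine (Finset.sum_le_card_nsmul _ _ _ fun l _ => ?_).trans (by rw [Finset.card_fin])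
  exact measure_adapted_le _ l (measurable_iterate lo bri fo u l.2.le)
    (fun tape s => iterate_update_of_le lo bri fo u tape l s le_rfl)
    (measurableSet_deviation bri fo hu e c) fun tape =>
      measure_deviation_le bri fo hM hu (le_iterate lo bri fo hP u tape l.2.le) hc he

end Deviation

/-! ### Convergence -/

section Convergence

theorem abs_sum_mul_sub_le {X : Type} [Fintype X] {a b v : X → ℝ} {e k : ℝ}
    (hab : ∀ j, |a j - b j| ≤ e) (hv : 0 ≤ v) (hk : ∑ j, v j ≤ k) (he : 0 ≤ e) :
    |∑ j, a j * v j - ∑ j, b j * v j| ≤ e * k := by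
  rw [← Finset.sum_sub_distrib]
  calc |∑ j, (a j * v j - b j * v j)| ≤ ∑ j, |a j * v j - b j * v j| :=
        Finset.abs_sum_le_sum_abs _ _
    _ ≤ ∑ j, e * v j := Finset.sum_le_sum fun j _ => by
        rw [← sub_mul, abs_mul, abs_of_nonneg (hv j)]
        exact mul_le_mul_of_nonneg_right (hab j) (hv j)
    _ ≤ e * k := by rw [← Finset.mul_sum]; exact mul_le_mul_of_nonneg_left hk he

variable {X ι : Type} [Fintype X] [DecidableEq X] [Fintype ι] [Nonempty ι]
  {f : ι → Finset X → ℝ} {M u : ℝ}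
  {Ω : Type*} [MeasurableSpace Ω] {Q : Measure Ω} {P : Set (X → ℝ)}
  (lo : LinearOracle P) (bri : BestResponseOracle f) (fo : FirstOrderOracle f M Q)

/-- The oracle's direction beats `w` for the estimated gradient. Exchanging estimate and mean once
for each of the two directions costs `e * k` each time, and the value of `w` under the mean gradient
is at least the current gap. -/
theorem smoothedExt_step (hf : IsBoundedFamily f M) (hM : 0 ≤ M) (hu : 0 < u)
    (hP : P ⊆ unitCube X) {k : ℝ} (hk : ∀ v ∈ P, ∑ j, v j ≤ k) {K c : ℕ} (hK : 0 < K)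
    {x : X → ℝ} (hx : ∀ j, u ≤ x j) {s : Fin c → (X → ℝ) × Ω} {e : ℝ} (he : 0 ≤ e)
    (hs : (x, s) ∉ deviation bri fo u e c) {w : X → ℝ} (hw : w ∈ P) :
    smoothedExt f u x + (minExt f w - smoothedExt f u x - 2 * e * k - M * k ^ 2 / (u * K)) / K ≤
      smoothedExt f u (x + fun j => direction lo bri fo s x j / K) := by
  have hK' : (0 : ℝ) < K := by exact_mod_cast hK
  set v := direction lo bri fo s x with hvdef
  have hvP : v ∈ P := lo.answer_mem _
  have hv0 : 0 ≤ v := (hP hvP).1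
  have hdev : ∀ j, |(averageGradient bri fo s x).val j - meanAscent bri u x j| ≤ e := by
    intro j
    by_contra hc
    exact hs (Set.mem_iUnion.2 ⟨j, (not_le.1 hc).le⟩)
  have h1 := smoothedExt_add_ge bri hf hM hu hx (h := fun j => v j / K)
    fun j => div_nonneg (hv0 j) hK'.le
  have h2 := le_smoothedExt_add bri hf hM hu hx (hP hw)
  have h3 := abs_le.1 (abs_sum_mul_sub_le hdev hv0 (hk v hvP) he)
  have h4 := abs_le.1 (abs_sum_mul_sub_le hdev (hP hw).1 (hk w hw) he)
  have h5 := lo.le_answer (averageGradient bri fo s x).val w hw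
  have h6 : ∑ j, meanAscent bri u x j * (v j / K) = (∑ j, meanAscent bri u x j * v j) / K := by
    rw [Finset.sum_div]
    exact Finset.sum_congr rfl fun j _ => by rw [mul_div_assoc]
  have h7 : M / u * (∑ j, v j / K) ^ 2 ≤ M * k ^ 2 / (u * K) / K := by
    rw [← Finset.sum_div, div_pow]
    have : (∑ j, v j) ^ 2 ≤ k ^ 2 :=
      pow_le_pow_left₀ (Finset.sum_nonneg fun j _ => hv0 j) (hk v hvP) 2
    calc M / u * ((∑ j, v j) ^ 2 / K ^ 2) ≤ M / u * (k ^ 2 / K ^ 2) := by gcongr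
      _ = _ := by field_simp
  have h8 : (minExt f w - smoothedExt f u x - 2 * e * k) / K ≤
      (∑ j, meanAscent bri u x j * v j) / K := by
    refine div_le_div_of_nonneg_right ?_ hK'.le
    have : ∑ j, (averageGradient bri fo s x).val j * w j ≤
      ∑ j, (averageGradient bri fo s x).val j * v j := h5
    linarith [h3.1, h3.2, h4.1, h4.2]
  rw [h6] at h1
  rw [sub_div _ (M * k ^ 2 / (u * K))]
  linarith

/-- The gap obeys `g' ≤ (1 - 1/K) * g + E/K`, a recursion with fixed point `E`, so the errors never
accumulate beyond `E`. Initially the gap is at most `minExt f w`, and `(1 - 1/K)^K ≤ 1/e`. -/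
theorem minExt_sub_smoothedExt_le (hf : IsBoundedFamily f M) (hM : 0 ≤ M) (hu : 0 < u)
    (hP : P ⊆ unitCube X) {k : ℝ} (hk0 : 0 ≤ k) (hk : ∀ v ∈ P, ∑ j, v j ≤ k) {K c : ℕ}
    (hK : 0 < K) {tape : Fin K → Fin c → (X → ℝ) × Ω} {e : ℝ} (he : 0 ≤ e)
    (ht : ∀ l : Fin K, (iterate lo bri fo u tape l, tape l) ∉ deviation bri fo u e c)
    {w : X → ℝ} (hw : w ∈ P) :
    minExt f w - smoothedExt f u (iterate lo bri fo u tape K) ≤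
      1 / Real.exp 1 * minExt f w + (2 * e * k + M * k ^ 2 / (u * K)) := by
  have hK' : (1 : ℝ) ≤ K := by exact_mod_cast hK
  set E := 2 * e * k + M * k ^ 2 / (u * K) with hE
  have hE0 : 0 ≤ E := by positivity
  have hr : 0 ≤ 1 - 1 / (K : ℝ) := by
    rw [sub_nonneg, div_le_one (by linarith)]; exact hK'
  have h : ∀ m ≤ K, minExt f w - smoothedExt f u (iterate lo bri fo u tape m) ≤
      (1 - 1 / (K : ℝ)) ^ m * minExt f w + E := by
    intro m
    induction m with
    | zero =>
      intro _
      have := smoothedExt_nonneg (u := u) hf (le_iterate lo bri fo hP u tape (Nat.zero_le K))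
      rw [pow_zero, one_mul]
      linarith
    | succ m ih =>
      intro hm
      have h1 := smoothedExt_step lo bri fo hf hM hu hP hk hK
        (le_iterate lo bri fo hP u tape (m := m) (by omega)) he (ht ⟨m, hm⟩) hw
      have h2 := iterate_succ lo bri fo u tape ⟨m, hm⟩
      simp only at h1 h2
      rw [← h2] at h1
      have h3 := mul_le_mul_of_nonneg_left (ih (by omega)) hr
      have h4 : minExt f w - smoothedExt f u (iterate lo bri fo u tape m) -
          (minExt f w - smoothedExt f u (iterate lo bri fo u tape m) - 2 * e * k -
            M * k ^ 2 / (u * K)) / K = (1 - 1 / (K : ℝ)) *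
              (minExt f w - smoothedExt f u (iterate lo bri fo u tape m)) + E / K := by
        rw [hE]; ring
      have h5 : (1 - 1 / (K : ℝ)) * ((1 - 1 / (K : ℝ)) ^ m * minExt f w + E) + E / K =
          (1 - 1 / (K : ℝ)) ^ (m + 1) * minExt f w + E := by ring
      linarith
  refine (h K le_rfl).trans (add_le_add_left (mul_le_mul_of_nonneg_right ?_
    (minExt_nonneg hf (hP hw))) _)
  have := Real.one_sub_div_pow_le_exp_neg (n := K) (t := 1) hK'
  rwa [Real.exp_neg, ← one_div] at this

theorem measure_success_ge [IsProbabilityMeasure Q] (hf : IsBoundedFamily f M) (hM : 0 < M)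
    (hu : 0 < u) (hP : P ⊆ unitCube X) (hconv : Convex ℝ P) {k : ℝ} (hk0 : 0 ≤ k)
    (hk : ∀ v ∈ P, ∑ j, v j ≤ k) {K c : ℕ} (hK : 0 < K) (hc : 0 < c) {e ε δ : ℝ} (he : 0 ≤ e)
    (h1 : 2 * u * M * Fintype.card X + (2 * e * k + M * k ^ 2 / (u * K)) ≤ ε)
    (h2 : K * (Fintype.card X * (2 * Real.exp (-(c * e ^ 2 / (2 * M ^ 2))))) ≤ δ)
    {w : X → ℝ} (hw : w ∈ P) :
    ENNReal.ofReal (1 - δ) ≤ tapeLaw X Q u K c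
      {tape | (1 - 1 / Real.exp 1) * minExt f w - ε ≤
          minExt f (stochasticFrankWolfe lo bri fo u K c tape).val.2 ∧
        (1 - 1 / Real.exp 1) * minExt f w - ε ≤
          minExt f (clip (stochasticFrankWolfe lo bri fo u K c tape).val.1)} := by
  have := isProbabilityMeasure_uniformNoise X hu
  have : IsProbabilityMeasure (tapeLaw X Q u K c) := by unfold tapeLaw; infer_instance
  set bad : Set (Fin K → Fin c → (X → ℝ) × Ω) := ⋃ l : Fin K,
    {tape | (iterate lo bri fo u tape l, tape l) ∈ deviation bri fo u e c} with hbad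
  have hδ : tapeLaw X Q u K c bad ≤ ENNReal.ofReal δ :=
    (measure_iterate_deviation_le lo bri fo hP hM hu hc he).trans (ENNReal.ofReal_le_ofReal h2)
  have hδ0 : 0 ≤ δ := le_trans (by positivity) h2
  have hcompl : ENNReal.ofReal (1 - δ) ≤ tapeLaw X Q u K c badᶜ := by
    rw [ENNReal.ofReal_sub _ hδ0, ENNReal.ofReal_one, tsub_le_iff_right]
    calc 1 = tapeLaw X Q u K c (badᶜ ∪ bad) := by rw [Set.compl_union_self, measure_univ]
      _ ≤ _ := (measure_union_le _ _).trans (add_le_add_right hδ _)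
  refine hcompl.trans (measure_mono fun tape ht => ?_)
  have ht' : ∀ l : Fin K, (iterate lo bri fo u tape l, tape l) ∉ deviation bri fo u e c :=
    fun l hl => ht (Set.mem_iUnion.2 ⟨l, hl⟩)
  have h3 := minExt_sub_smoothedExt_le lo bri fo hf hM.le hu hP hk0 hk hK he ht' hw
  rw [Set.mem_ofPred_eq, stochasticFrankWolfe_val]
  have hmem := hP (iterate_sub_mem lo bri fo hconv u hK tape)
  have h4 := smoothedExt_le (u := u) hf hM.le hu hmem
  simp only [sub_add_cancel] at h4
  have h5 : (1 - 1 / Real.exp 1) * minExt f w - ε ≤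
      minExt f fun j => iterate lo bri fo u tape K j - u := by linarith
  -- The second bound follows from the first, since `x_final ≤ x^K ∧ 1`.
  refine ⟨h5, h5.trans (minExt_mono hf hmem (clip_mem_unitCube fun j => ?_) fun j => ?_)⟩
  · exact hu.le.trans (le_iterate lo bri fo hP u tape le_rfl j)
  · exact le_min (by linarith) (hmem.2 j)

end Convergence

/-! ### The choice of the parameters -/

section Parameters

theorem half_le_log_two_add {a : ℝ} (ha : 0 ≤ a) : 1 / 2 ≤ Real.log (2 + a) :=
  (by linarith [Real.log_two_gt_d9] : 1 / 2 ≤ Real.log 2).trans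
    (Real.log_le_log two_pos (by linarith))

theorem exists_parameters {ε δ M : ℝ} {n k : ℕ} (hε : 0 < ε) (hδ : 0 < δ) (hn : 0 < n)
    (hkM : ε < k * M) :
    ∃ (u : ℝ) (K c : ℕ), 0 < u ∧ 0 < K ∧ 0 < c ∧
      2 * u * M * n + (2 * (ε / (6 * k)) * k + M * k ^ 2 / (u * K)) ≤ ε ∧
      K * (n * (2 * Real.exp (-(c * (ε / (6 * k)) ^ 2 / (2 * M ^ 2))))) ≤ δ ∧
      (K : ℝ) ≤ 19 * (M ^ 2 * k ^ 2 * n / ε ^ 2) ∧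
      (K * c : ℝ) ≤ 13870 * ((k ^ 4 * M ^ 4 * n / ε ^ 4) * max 1 (Real.log (1 / δ)) *
        Real.log (2 + n * k * M / ε)) := by
  have hk : (0 : ℝ) < k := by
    rcases Nat.eq_zero_or_pos k with h | h
    · rw [h, Nat.cast_zero, zero_mul] at hkM; linarith
    · exact_mod_cast h
  have hM : 0 < M := pos_of_mul_pos_right (hε.trans hkM) hk.le
  have hn1 : (1 : ℝ) ≤ n := by exact_mod_cast hn
  have hn0 : (0 : ℝ) < n := by linarith
  set b := k * M / ε with hb
  have hb1 : 1 < b := by rw [hb, one_lt_div hε]; exact hkM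
  have hb0 : 0 < b := by linarith
  -- With `u = ε / (6 * M * n)` the curvature error is `6 * b ^ 2 * n * ε / K`, so this makes it at
  -- most `ε / 3`.
  set K := ⌈18 * b ^ 2 * n⌉₊ with hK
  have hb2n : 1 ≤ b ^ 2 * n := one_le_mul_of_one_le_of_one_le (one_le_pow₀ hb1.le) hn1
  have hKle : 18 * b ^ 2 * n ≤ K := Nat.le_ceil _
  have hK19 : (K : ℝ) ≤ 19 * (b ^ 2 * n) := by
    have := (Nat.ceil_lt_add_one (a := 18 * b ^ 2 * n) (by positivity)).le
    linarith
  have hK1 : (1 : ℝ) ≤ K := by linarith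
  set m := max 1 (Real.log (1 / δ)) with hm
  have hm1 : 1 ≤ m := le_max_left _ _
  set L := Real.log (2 * n * K) + m with hL
  have hL1 : 1 ≤ L := by
    have := Real.log_nonneg (x := 2 * n * K) (by nlinarith)
    linarith
  -- For accuracy `ε / (6 * k)` the Hoeffding exponent is `c / (72 * b ^ 2)`; it must reach `L`,
  -- which pays for the union bound over `2 * n * K` one-sided events and for `δ`.
  set c := ⌈72 * b ^ 2 * L⌉₊ with hc
  have hcle : 72 * b ^ 2 * L ≤ c := Nat.le_ceil _
  have hb2L : 1 ≤ b ^ 2 * L := one_le_mul_of_one_le_of_one_le (one_le_pow₀ hb1.le) hL1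
  have hc73 : (c : ℝ) ≤ 73 * (b ^ 2 * L) := by
    have := (Nat.ceil_lt_add_one (a := 72 * b ^ 2 * L) (by positivity)).le
    linarith
  set ℓ := Real.log (2 + n * k * M / ε) with hℓ
  have hnb : n * k * M / ε = n * b := by rw [hb]; ring
  have hℓ2 : 1 / 2 ≤ ℓ := half_le_log_two_add (by positivity)
  have hlog : Real.log (2 * n * K) ≤ 8 * ℓ := by
    have h1 : 2 * n * K ≤ (2 + n * b) ^ 8 := by
      calc (2 : ℝ) * n * K ≤ 2 * n * (19 * (b ^ 2 * n)) := by gcongr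
        _ ≤ 2 ^ 6 * (n * b) ^ 2 := by nlinarith [sq_nonneg (n * b)]
        _ ≤ (2 + n * b) ^ 6 * (2 + n * b) ^ 2 := by
            gcongr <;> nlinarith [mul_pos hn0 hb0]
        _ = _ := by ring
    have h2 := Real.log_le_log (by positivity) h1
    rw [Real.log_pow] at h2
    rw [hℓ, hnb]
    exact_mod_cast h2
  -- `8 * ℓ ≤ 8 * (m * ℓ)` because `1 ≤ m`, and `m ≤ 2 * (m * ℓ)` because `1/2 ≤ ℓ`. Then `13870 =
  -- 19 * 73 * 10`.
  have hL10 : L ≤ 10 * (m * ℓ) := by nlinarith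
  refine ⟨ε / (6 * M * n), K, c, by positivity, by exact_mod_cast (by linarith : (0 : ℝ) < K),
    by exact_mod_cast (by nlinarith : (0 : ℝ) < c), ?_, ?_, ?_, ?_⟩
  · have h1 : 2 * (ε / (6 * M * n)) * M * n = ε / 3 := by field_simp; norm_num
    have h2 : 2 * (ε / (6 * k)) * k = ε / 3 := by field_simp; norm_num
    have h3 : M * k ^ 2 / (ε / (6 * M * n) * K) ≤ ε / 3 := by
      have h4 : M * k ^ 2 / (ε / (6 * M * n) * K) = 6 * (b ^ 2 * n) * ε / K := by
        rw [hb]; field_simp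
      rw [h4, div_le_div_iff₀ (by linarith) (by norm_num)]
      nlinarith
    linarith
  · have h1 : c * (ε / (6 * k)) ^ 2 / (2 * M ^ 2) = c / (72 * b ^ 2) := by
      rw [hb]; field_simp; ring
    have h2 : L ≤ c / (72 * b ^ 2) := by
      rw [le_div_iff₀ (by positivity)]; linarith
    have h3 : Real.exp (-(c / (72 * b ^ 2))) ≤ (2 * n * K : ℝ)⁻¹ * δ := by
      calc Real.exp (-(c / (72 * b ^ 2)))
          ≤ Real.exp (-Real.log (2 * n * K) + -Real.log (1 / δ)) := by
            refine Real.exp_le_exp.2 ?_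
            have : Real.log (1 / δ) ≤ m := le_max_right _ _
            linarith
        _ = _ := by
            rw [Real.exp_add, Real.exp_neg, Real.exp_log (by positivity), one_div, Real.log_inv,
              neg_neg, Real.exp_log hδ]
    rw [h1]
    calc K * (n * (2 * Real.exp (-(c / (72 * b ^ 2)))))
        ≤ K * (n * (2 * ((2 * n * K : ℝ)⁻¹ * δ))) := by gcongr
      _ = δ := by field_simp
  · refine hK19.trans (le_of_eq ?_)
    rw [hb]; field_simp
  · calc (K * c : ℝ) ≤ (19 * (b ^ 2 * n)) * (73 * (b ^ 2 * (10 * (m * ℓ)))) := by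
          refine mul_le_mul hK19 (hc73.trans ?_) (Nat.cast_nonneg _) (by positivity)
          gcongr
      _ = 13870 * ((b ^ 4 * n) * m * ℓ) := by ring
      _ = _ := by
          congr 3
          rw [hb]; field_simp

end Parameters

/-! ### The running time -/

section RunningTime

/-- The bound on `K` carries no logarithm, so `1 ≤ 2 * ℓ` supplies one. The constant covers `9 * 38`
and `7 * 13870 = 97090`. -/
theorem le_mul_log_of_le {A B T₁ T₂ ℓ t K c : ℝ} (hT₁ : 0 ≤ T₁) (hT₂ : 0 ≤ T₂)
    (ht : t ≤ 9 * (K * T₁) + 7 * (K * c * T₂)) (hℓ : 1 / 2 ≤ ℓ) (hA0 : 0 ≤ A) (hB0 : 0 ≤ B)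
    (hA : K ≤ 19 * A) (hB : K * c ≤ 13870 * (B * ℓ)) :
    t ≤ 100000 * (T₁ * A + T₂ * B) * ℓ ^ 1 := by
  have h1 : K * T₁ ≤ 38 * (A * ℓ) * T₁ := mul_le_mul_of_nonneg_right (by nlinarith) hT₁
  have h2 : K * c * T₂ ≤ 13870 * (B * ℓ) * T₂ := mul_le_mul_of_nonneg_right hB hT₂
  have h3 : 0 ≤ A * ℓ * T₁ := by positivity
  have h4 : 0 ≤ B * ℓ * T₂ := by positivity
  rw [pow_one]
  linarith

end RunningTime

end SFW

/-! ### The main theorem -/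

theorem mainTheorem2 :
    -- absolute constants of the bound on the running time
    ∃ C : ℝ, 0 < C ∧ ∃ p : ℕ,
    ∀ (ε δ : ℝ), 0 < ε → 0 < δ → ∀ (n k : ℕ) (M : ℝ),
    -- the parameters: smoothing radius, number of iterations, samples per iteration
    ∃ (u : ℝ) (K c : ℕ), 0 < u ∧ 0 < K ∧ 0 < c ∧
    -- the instance
    ∀ (X ι : Type) [Fintype X] [DecidableEq X] [Fintype ι] [Nonempty ι]
      (f : ι → Finset X → ℝ) (I : Matroid X),
      Fintype.card X = n →
      (∀ i, SFW.IsSubmodular (f i)) → (∀ i, Monotone (f i)) → (∀ i, f i ∅ = 0) →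
      IsGreatest (Set.range fun a : ι × X => f a.1 {a.2}) M →
      I.eRank = (k : ℕ∞) →
    -- the oracles, with bounds on their running times
    ∀ (Ω : Type*) [MeasurableSpace Ω] (Q : MeasureTheory.Measure Ω)
      [MeasureTheory.IsProbabilityMeasure Q]
      (lo : SFW.LinearOracle (SFW.polytope I)) (bri : SFW.BestResponseOracle f)
      (fo : SFW.FirstOrderOracle f M Q) (T₁ T₂ : ℕ),
      (∀ w, lo.time w ≤ T₁) →
      (∀ x ω, bri.time x + fo.time (bri.answer x) x ω ≤ T₂) →
    -- the maximum of `G` over the polytope is attained, and the algorithm approximates it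
    ∃ opt : ℝ, IsGreatest (SFW.minExt f '' SFW.polytope I) opt ∧
      ENNReal.ofReal (1 - δ) ≤ SFW.tapeLaw X Q u K c
        {tape |
          (1 - 1 / Real.exp 1) * opt - ε ≤
            SFW.minExt f (SFW.stochasticFrankWolfe lo bri fo u K c tape).val.2 ∧
          (1 - 1 / Real.exp 1) * opt - ε ≤
            SFW.minExt f
              (SFW.clip (SFW.stochasticFrankWolfe lo bri fo u K c tape).val.1)} ∧
      ∀ tape,
        (SFW.stochasticFrankWolfe lo bri fo u K c tape).val.2 ∈ SFW.polytope I ∧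
        ((SFW.stochasticFrankWolfe lo bri fo u K c tape).time : ℝ) ≤
          C * (T₁ * max 1 (M ^ 2 * (k : ℝ) ^ 2 * n / ε ^ 2) +
              T₂ * (max 1 ((k : ℝ) ^ 4 * M ^ 4 * n / ε ^ 4) * max 1 (Real.log (1 / δ)))) *
            Real.log (2 + n * k * M / ε) ^ p := by
  refine ⟨100000, by norm_num, 1, fun ε δ hε hδ n k M => ?_⟩
  -- The parameters precede the instance, so the split is on numbers only. The case `n = 0` admits
  -- no instance, because `M` is attained at some item. If `k * M ≤ ε`, a single iteration with one
  -- sample suffices, and the maxima with `1` in the time bound cover it.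
  by_cases hcase : k * M ≤ ε ∨ n = 0
  · refine ⟨1, 1, 1, one_pos, one_pos, one_pos, ?_⟩
    intro X ι _ _ _ _ f I hX hsub hmono h0 hM hI Ω _ Q _ lo bri fo T₁ T₂ hT₁ hT₂
    obtain ⟨⟨⟨i₀, j₀⟩, hij⟩, hMub⟩ := hM
    have hf : SFW.IsBoundedFamily f M := ⟨hsub, hmono, h0, fun i j => hMub ⟨(i, j), rfl⟩⟩
    have hM0 : 0 ≤ M := by
      rw [← hij, ← h0 i₀]
      exact hmono i₀ (Finset.empty_subset _)
    have hXpos : 0 < Fintype.card X := Fintype.card_pos_iff.2 ⟨j₀⟩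
    have hkM : k * M ≤ ε := hcase.resolve_right (by omega)
    have hP := SFW.polytope_subset_unitCube I
    obtain ⟨w, hw, hmax⟩ := (SFW.isCompact_polytope I).exists_isMaxOn (SFW.polytope_nonempty I)
      (SFW.continuous_minExt f).continuousOn
    refine ⟨SFW.minExt f w, ⟨⟨w, hw, rfl⟩, ?_⟩, ?_, fun tape => ⟨?_, ?_⟩⟩
    · rintro _ ⟨v, hv, rfl⟩
      exact hmax hv
    · have := SFW.isProbabilityMeasure_uniformNoise X one_pos
      have : IsProbabilityMeasure (SFW.tapeLaw X Q 1 1 1) := by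
        unfold SFW.tapeLaw; infer_instance
      -- The optimum is at most `M * k ≤ ε`, so any output with nonnegative value meets the
      -- guarantee.
      have hopt : (1 - 1 / Real.exp 1) * SFW.minExt f w - ε ≤ 0 := by
        have h1 := SFW.minExt_le_add hf SFW.zero_mem_unitCube (hP hw) (hP hw).1
        simp only [SFW.minExt_zero hf, Pi.zero_apply, sub_zero, zero_add] at h1
        have h2 := mul_le_mul_of_nonneg_left (SFW.sum_le_of_mem_polytope hI hw) hM0
        have h3 : 0 ≤ 1 / Real.exp 1 * SFW.minExt f w :=
          mul_nonneg (by positivity) (SFW.minExt_nonneg hf (hP hw))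
        linarith
      calc ENNReal.ofReal (1 - δ) ≤ 1 := by
            rw [ENNReal.ofReal_le_one]; linarith
        _ = SFW.tapeLaw X Q 1 1 1 Set.univ := measure_univ.symm
        _ ≤ _ := measure_mono fun tape _ => by
            rw [Set.mem_ofPred_eq, SFW.stochasticFrankWolfe_val]
            refine ⟨hopt.trans (SFW.minExt_nonneg hf (hP ?_)),
              hopt.trans (SFW.minExt_nonneg hf (SFW.clip_mem_unitCube fun j => ?_))⟩
            · exact SFW.iterate_sub_mem lo bri fo (SFW.convex_polytope I) 1 one_pos tape
            · exact zero_le_one.trans (SFW.le_iterate lo bri fo hP 1 tape le_rfl j)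
    · rw [SFW.stochasticFrankWolfe_val]
      exact SFW.iterate_sub_mem lo bri fo (SFW.convex_polytope I) 1 one_pos tape
    · have ht := SFW.stochasticFrankWolfe_time_le lo bri fo 1 one_pos one_pos hXpos hT₁ hT₂ tape
      have hℓ := SFW.half_le_log_two_add (a := n * k * M / ε) (by positivity)
      refine SFW.le_mul_log_of_le (K := (1 : ℕ)) (c := (1 : ℕ)) (Nat.cast_nonneg _)
        (Nat.cast_nonneg _) (by exact_mod_cast ht) hℓ (by positivity) (by positivity) ?_ ?_
      · rw [Nat.cast_one]
        linarith [le_max_left 1 (M ^ 2 * (k : ℝ) ^ 2 * n / ε ^ 2)]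
      · have := one_le_mul_of_one_le_of_one_le (le_max_left 1 ((k : ℝ) ^ 4 * M ^ 4 * n / ε ^ 4))
          (le_max_left 1 (Real.log (1 / δ)))
        rw [Nat.cast_one]
        nlinarith
  · rw [not_or, not_le] at hcase
    obtain ⟨u, K, c, hu, hK, hc, herr, hprob, hKle, hKc⟩ :=
      SFW.exists_parameters hε hδ (Nat.pos_of_ne_zero hcase.2) hcase.1
    refine ⟨u, K, c, hu, hK, hc, ?_⟩
    intro X ι _ _ _ _ f I hX hsub hmono h0 hM hI Ω _ Q _ lo bri fo T₁ T₂ hT₁ hT₂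
    have hf : SFW.IsBoundedFamily f M := ⟨hsub, hmono, h0, fun i j => hM.2 ⟨(i, j), rfl⟩⟩
    have hM0 : 0 < M := pos_of_mul_pos_right (hε.trans hcase.1) (Nat.cast_nonneg k)
    have hP := SFW.polytope_subset_unitCube I
    obtain ⟨w, hw, hmax⟩ := (SFW.isCompact_polytope I).exists_isMaxOn (SFW.polytope_nonempty I)
      (SFW.continuous_minExt f).continuousOn
    refine ⟨SFW.minExt f w, ⟨⟨w, hw, rfl⟩, ?_⟩, ?_, fun tape => ⟨?_, ?_⟩⟩
    · rintro _ ⟨v, hv, rfl⟩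
      exact hmax hv
    · rw [← hX] at herr hprob
      exact SFW.measure_success_ge lo bri fo hf hM0 hu hP (SFW.convex_polytope I)
        (Nat.cast_nonneg k) (fun v hv => SFW.sum_le_of_mem_polytope hI hv) hK hc
        (e := ε / (6 * k)) (by positivity) herr hprob hw
    · rw [SFW.stochasticFrankWolfe_val]
      exact SFW.iterate_sub_mem lo bri fo (SFW.convex_polytope I) u hK tape
    · have ht := SFW.stochasticFrankWolfe_time_le lo bri fo u hK hc
        (hX ▸ Nat.pos_of_ne_zero hcase.2) hT₁ hT₂ tape
      have hℓ := SFW.half_le_log_two_add (a := n * k * M / ε) (by positivity)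
      refine SFW.le_mul_log_of_le (K := K) (c := c) (Nat.cast_nonneg _)
        (Nat.cast_nonneg _) (by exact_mod_cast ht) hℓ (by positivity) (by positivity) ?_ ?_
      · exact hKle.trans (mul_le_mul_of_nonneg_left (le_max_right _ _) (by norm_num))
      · refine hKc.trans (mul_le_mul_of_nonneg_left ?_ (by norm_num))
        refine mul_le_mul_of_nonneg_right ?_ (by linarith)
        exact mul_le_mul_of_nonneg_right (le_max_right _ _) (by positivity)
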